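/- **Proposition 3.2.** Let $\alpha,\beta\in(0,1]$, $p\in[1,2)$ and let $\theta_0\in L^2(\mathbb R^2)\cap L^p(\mathbb R^2)$ be real-valued. Consider the surface quasi-geostrophic equation $$\partial_t\theta+u\cdot\nabla\theta+\mathcal L\theta=0,\qquad u=(-\partial_{x_2}\Lambda^{-1}\theta,\ \partial_{x_1}\Lambda^{-1}\theta),\qquad \theta(\cdot,0)=\theta_0,$$ on $\mathbb R^2\times[0,\infty)$, where $\mathcal L=\Lambda_{x_1}^{2\alpha}+\Lambda_{x_2}^{2\beta}$ or, if $\alpha=\beta$, also $\mathcal L=\Lambda^{2\alpha}$. Here $\Lambda_{x_j}^{s}$ and $\Lambda^s$ are the Fourier multipliers with symbols $|\xi_j|^s$ and $|\xi|^s$ (for the Fourier transform with kernel $e^{-ix\cdot\xi}$). Write $D(f)=\|\Lambda_{x_1}^{\alpha}f\|_{L^2}^2+\|\Lambda_{x_2}^{\beta}f\|_{L^2}^2$ (respectively $D(f)=\|\Lambda^\alpha f\|_{L^2}^2$ in the case $\mathcal L=\Lambda^{2\alpha}$), with $D(f)=\infty$ if these are not in $L^2$. A *weak solution* is a strongly measurable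 real-valued $\theta:[0,\infty)\to L^2(\mathbb R^2)$ such that 1. for all $\varphi\in\mathcal S(\mathbb R^2)$ and all $t\ge0$, $$\int\theta(t)\varphi\,dx=\int\theta_0\varphi\,dx+\int_0^t\!\!\int\theta\,u\cdot\nabla\varphi\,dx\,ds-\int_0^t\!\!\int\theta\,\mathcal L\varphi\,dx\,ds;$$ 2. (energy inequality) for almost every $s\geq 0$ and all $t\ge s$, $\ \|\theta(t)\|_{L^2}^2+2\int_s^tD(\theta(\tau))\,d\tau\le\|\theta(s)\|_{L^2}^2$; and the same holds for $s=0$ and all $t\ge 0$, with $\theta_0$ in place of $\theta(s)$. Then there is a constant $C_0>0$, depending only on $\alpha,\beta,p$ and $\theta_0$, such that every weak solution with initial value $\theta_0$ satisfies $$\|\theta(t)\|_{L^2}\le C_0(1+t)^{-\frac{(\alpha+\beta)(2-p)}{4\alpha\beta p}}\qquad\text{for all }t\ge0 .$$ -/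

import Mathlib

open MeasureTheory Set
open scoped FourierTransform SchwartzMap ENNReal

namespace AnisoSQG

/-- The plane `ℝ²` with its Euclidean norm. -/
abbrev Plane : Type := EuclideanSpace ℝ (Fin 2)

/-- Real-valued `L²(ℝ²)`. -/
abbrev L2R : Type := Lp ℝ 2 (volume : Measure Plane)

/-- Complex-valued `L²(ℝ²)`. -/
abbrev L2C : Type := Lp ℂ 2 (volume : Measure Plane)

/-- A real-valued `L²` function, regarded as a complex-valued one. -/
noncomputable def toComplex (f : L2R) : L2C := Complex.ofRealCLM.compLp f

open Classical in
/-- The Fourier multiplier operator `f ↦ 𝓕⁻¹ (m · 𝓕 f)` on its natural domain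
`{f ∈ L² : m · 𝓕 f ∈ L²}` (extended by `0` outside of the domain). Here `𝓕` is the unitary Fourier
transform of Mathlib, with kernel `exp (- 2 π i x · ξ)`; thus `∂_j` has the symbol `2 π i ξ_j`. -/
noncomputable def multiplier (m : Plane → ℂ) (f : L2C) : L2C :=
  if h : MemLp (fun ξ => m ξ * (𝓕 f : L2C) ξ) 2 (volume : Measure Plane) then
    𝓕⁻ (h.toLp (fun ξ => m ξ * (𝓕 f : L2C) ξ))
  else 0

/-- The symbol of `Λ_{x₁}^{2α} + Λ_{x₂}^{2β}`. -/
noncomputable def anisotropicSymbol (α β : ℝ) (ξ : Plane) : ℝ :=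
  |2 * Real.pi * ξ 0| ^ (2 * α) + |2 * Real.pi * ξ 1| ^ (2 * β)

/-- The symbol of `Λ^{2α} = (-Δ)^α`. -/
noncomputable def isotropicSymbol (α : ℝ) (ξ : Plane) : ℝ :=
  (2 * Real.pi * ‖ξ‖) ^ (2 * α)

/-- The symbols of the two components of `∇^⊥ Λ⁻¹ = (-∂₂ Λ⁻¹, ∂₁ Λ⁻¹)`. They are homogeneous of
degree `0`, so that the factors `2 π` cancel. -/
noncomputable def velocitySymbol (j : Fin 2) (ξ : Plane) : ℂ :=
  if j = 0 then -(Complex.I * (ξ 1 : ℂ) / (‖ξ‖ : ℂ)) else Complex.I * (ξ 0 : ℂ) / (‖ξ‖ : ℂ)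

/-- The velocity `u = (-∂₂ Λ⁻¹ f, ∂₁ Λ⁻¹ f)`. -/
noncomputable def velocity (f : L2R) (j : Fin 2) : L2C :=
  multiplier (velocitySymbol j) (toComplex f)

/-- `∫ f (u · ∇φ) dx`, where `u` is the velocity of `f`. -/
noncomputable def transport (f : L2R) (φ : 𝓢(Plane, ℂ)) : ℂ :=
  ∑ j : Fin 2, ∫ x : Plane,
    toComplex f x * velocity f j x * fderiv ℝ φ x (EuclideanSpace.single j (1 : ℝ))

/-- `∫ f g dx` (bilinear, no complex conjugation). -/
noncomputable def pairing (f : L2R) (g : L2C) : ℂ := ∫ x : Plane, toComplex f x * g x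

/-- The dissipation `∫ m |𝓕 f|² dξ`, possibly infinite. By Plancherel it is
`‖Λ_{x₁}^α f‖² + ‖Λ_{x₂}^β f‖²` when `m` is the symbol of `Λ_{x₁}^{2α} + Λ_{x₂}^{2β}`, and
`‖Λ^α f‖²` when `m` is the symbol of `Λ^{2α}`. -/
noncomputable def dissipation (m : Plane → ℝ) (f : L2R) : ℝ≥0∞ :=
  ∫⁻ ξ : Plane, ENNReal.ofReal (m ξ) * ‖(𝓕 (toComplex f) : L2C) ξ‖ₑ ^ 2

/-- Weak (Leray-Hopf) solutions on `[0, ∞)` of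
`∂ₜ θ + u · ∇θ + m(D) θ = 0`, `u = (-∂₂ Λ⁻¹ θ, ∂₁ Λ⁻¹ θ)`, with initial value `θ₀ ∈ L²`.
Only the values of `θ` at times `t ≥ 0` matter. The energy inequality contains the usual regularity
class: `θ` is bounded in `L²`, and the dissipation is integrable in time. -/
structure IsWeakSolution (m : Plane → ℝ) (θ₀ : L2R) (θ : ℝ → L2R) : Prop where
  measurable : AEStronglyMeasurable θ (volume.restrict (Ici (0 : ℝ)))
  /-- The equation in the sense of distributions, integrated over `[0, t]`, together with the
  initial condition (`u` is divergence free, so `u · ∇θ = ∇ · (θ u)`). -/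
  weak_form : ∀ φ : 𝓢(Plane, ℂ), ∀ t : ℝ, 0 ≤ t →
    pairing (θ t) (φ.toLp 2) = pairing θ₀ (φ.toLp 2)
      + (∫ s in (0 : ℝ)..t, transport (θ s) φ)
      - ∫ s in (0 : ℝ)..t, pairing (θ s) (multiplier (fun ξ => (m ξ : ℂ)) (φ.toLp 2))
  /-- The energy inequality starting from time `0`. -/
  energy_zero : ∀ t : ℝ, 0 ≤ t →
    ‖θ t‖ₑ ^ 2 + 2 * ∫⁻ τ in Icc 0 t, dissipation m (θ τ) ≤ ‖θ₀‖ₑ ^ 2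
  /-- The energy inequality starting from almost every later time. -/
  energy : ∀ᵐ s ∂(volume.restrict (Ici (0 : ℝ))), ∀ t : ℝ, s ≤ t →
    ‖θ t‖ₑ ^ 2 + 2 * ∫⁻ τ in Icc s t, dissipation m (θ τ) ≤ ‖θ s‖ₑ ^ 2

end AnisoSQG

/-! The proof is Schonbek's Fourier splitting. Put y = ‖θ‖², σ = 1/(2α) + 1/(2β), r = σ(2 - p)/p and
g = κ/(1 + t). Frequencies whose symbol exceeds g are damped at rate at least g, so the energy
inequality becomes, in integrated form, y' ≤ -2g(y - F), where F bounds the squared L² norm of the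
low frequencies (`IsLowPass.le_dissipation`, `IsWeakSolution.splitEnergy`).

The low frequencies fill a box of measure about g^σ. Testing the equation with functions supported
there in frequency bounds F by a multiple of g^r + g^(1+σ) (∫₀ᵗ y)²
(`IsWeakSolution.lowNorm_sq_le`). The first term comes from the Lᵖ datum. The second comes from the
flux θu, which is in L¹; its derivative costs a multiple of √g because α, β ≤ 1. Dissipation inside
the box only costs a Gronwall factor, bounded because gt ≤ κ.

If κ > r, then y inherits the rate (1 + t)^(-r) from F (`SplitEnergy.le`). The trivial bound y ≤
‖θ₀‖² does not make the second term of F decay when σ = 1, so three rounds are used. Small κ makes y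
eventually small, hence ∫₀ᵗ y ≤ B + εt (`exists_integral_le`). One factor of (∫ y)² then carries a
small constant, and an absorption argument gives the rate min(r, 1/2) (`exists_slow_decay`).
Inserting this rate in F gives the rate r (`exists_decay`). All constants are chosen before the
solution. -/

namespace AnisoSQG

/-! ### Comparison principles for integrated energy inequalities -/

/-- Backward Gronwall comparison for functions satisfying an energy inequality. -/
theorem nonpos_of_energy {w h : ℝ → ℝ} {T : ℝ} (hT : 0 ≤ T) (hh : ∀ τ ∈ Icc 0 T, 0 ≤ h τ)
    (hint : IntervalIntegrable (fun τ => h τ * w τ) volume 0 T)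
    (h0 : w T + ∫ τ in (0 : ℝ)..T, h τ * w τ ≤ 0)
    (hs : ∀ᵐ s ∂(volume.restrict (Ici (0 : ℝ))), s ≤ T → w T + ∫ τ in s..T, h τ * w τ ≤ w s) :
    w T ≤ 0 := by
  by_contra! hw
  set f : ℝ → ℝ := fun τ => h τ * w τ with hf
  -- While w need not be continuous, v is, and v ≤ w almost everywhere. If w T > 0, then after the
  -- last point a with v a ≤ 0 the integrand is nonnegative, which forces v a ≥ w T > 0.
  set v : ℝ → ℝ := fun s => w T + ∫ τ in s..T, f τ with hv
  have hint' : IntegrableOn f (uIcc 0 T) := by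
    rw [intervalIntegrable_iff_integrableOn_Icc_of_le hT] at hint
    rwa [uIcc_of_le hT]
  have hcont : ContinuousOn v (Icc 0 T) := by
    have := intervalIntegral.continuousOn_primitive_interval_left hint'
    rw [uIcc_of_le hT] at this
    exact continuousOn_const.add this
  set Z : Set ℝ := Icc 0 T ∩ v ⁻¹' Iic 0 with hZ
  have hZc : IsCompact Z := isCompact_Icc.of_isClosed_subset
    (hcont.preimage_isClosed_of_isClosed isClosed_Icc isClosed_Iic) inter_subset_left
  have hZn : Z.Nonempty := ⟨0, ⟨le_rfl, hT⟩, h0⟩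
  obtain ⟨hsZ, hsv⟩ : sSup Z ∈ Z := hZc.sSup_mem hZn
  set a := sSup Z with ha
  have hpos : ∀ s ∈ Ioc a T, 0 < v s := by
    intro s hs
    by_contra! hle
    exact absurd (le_csSup hZc.bddAbove (show s ∈ Z from ⟨⟨hsZ.1.trans hs.1.le, hs.2⟩, hle⟩))
      (not_le.2 hs.1)
  have hnn : 0 ≤ ∫ τ in a..T, f τ := by
    rw [intervalIntegral.integral_of_le hsZ.2]
    apply setIntegral_nonneg_of_ae_restrict
    have h1 : volume.restrict (Ioc a T) ≤ volume.restrict (Ici (0 : ℝ)) :=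
      Measure.restrict_mono (fun x hx => hsZ.1.trans hx.1.le) le_rfl
    filter_upwards [ae_mono h1 hs, ae_restrict_mem measurableSet_Ioc] with s hs1 hs2
    have := hs1 hs2.2
    have h3 := hpos s hs2
    exact mul_nonneg (hh s ⟨hsZ.1.trans hs2.1.le, hs2.2⟩) (h3.le.trans this)
  have : v a ≤ 0 := hsv
  simp only [hv] at this
  linarith

/-- The energy inequality after Fourier splitting at the frequency level `κ / (1 + t)`. -/
structure SplitEnergy (E κ : ℝ) (F y : ℝ → ℝ) : Prop where
  zero : ∀ t, 0 ≤ t → y t + ∫ τ in (0 : ℝ)..t, 2 * (κ / (1 + τ)) * (y τ - F τ) ≤ E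
  ae : ∀ᵐ s ∂(volume.restrict (Ici (0 : ℝ))), ∀ t, s ≤ t →
    y t + ∫ τ in s..t, 2 * (κ / (1 + τ)) * (y τ - F τ) ≤ y s

theorem intervalIntegrable_of_bounded {y : ℝ → ℝ} {E : ℝ}
    (hm : AEStronglyMeasurable y (volume.restrict (Ici (0 : ℝ))))
    (hb : ∀ t, 0 ≤ t → 0 ≤ y t ∧ y t ≤ E) {a b : ℝ} (ha : 0 ≤ a) (hab : a ≤ b) :
    IntervalIntegrable y volume a b := by
  rw [intervalIntegrable_iff_integrableOn_Icc_of_le hab]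
  have hsub : Icc a b ⊆ Ici 0 := fun x hx => ha.trans hx.1
  refine Integrable.of_bound (hm.mono_measure (Measure.restrict_mono hsub le_rfl)) E ?_
  filter_upwards [ae_restrict_mem measurableSet_Icc] with x hx
  have := hb x (hsub hx)
  rw [Real.norm_of_nonneg this.1]
  exact this.2

/-- The function z = P + Q(1 + t)^(-ρ) is a supersolution: z - F ≥ (Q/2)(1 + t)^(-ρ), and the factor
2 in the energy inequality turns this into damping κQ(1 + t)^(-ρ-1) ≥ -z'. Comparison is applied to
y - z. -/
theorem SplitEnergy.le {E κ ρ P Q T : ℝ} {F y : ℝ → ℝ} (hE : SplitEnergy E κ F y)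
    (hm : AEStronglyMeasurable y (volume.restrict (Ici (0 : ℝ))))
    (hb : ∀ t, 0 ≤ t → 0 ≤ y t ∧ y t ≤ E)
    (hκ : 0 ≤ κ) (hρ : ρ ≤ κ) (hQ : 0 ≤ Q) (hT : 0 ≤ T)
    (hFc : ContinuousOn F (Icc 0 T))
    (hF : ∀ t ∈ Icc 0 T, F t ≤ P + Q / 2 * (1 + t) ^ (-ρ)) (hEQ : E ≤ P + Q) :
    y T ≤ P + Q * (1 + T) ^ (-ρ) := by
  set z : ℝ → ℝ := fun t => P + Q * (1 + t) ^ (-ρ) with hz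
  set h : ℝ → ℝ := fun t => 2 * (κ / (1 + t)) with hh
  have hhc : ContinuousOn h (Icc 0 T) := by
    apply ContinuousOn.mul continuousOn_const
    apply ContinuousOn.div continuousOn_const (by fun_prop)
    intro x hx; have := hx.1; positivity
  have hd : ∀ t ∈ Icc 0 T, HasDerivAt z (Q * (-ρ * (1 + t) ^ (-ρ - 1))) t := by
    intro t ht
    have h1 : HasDerivAt (fun t : ℝ => (1 + t)) 1 t := (hasDerivAt_id t).const_add 1
    have := (h1.rpow_const (p := -ρ) (Or.inl (by have := ht.1; positivity)))
    simpa [hz] using this.const_mul Q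
  have hzc : ContinuousOn z (Icc 0 T) := fun t ht => (hd t ht).continuousAt.continuousWithinAt
  have hdc : ContinuousOn (fun t => Q * (-ρ * (1 + t) ^ (-ρ - 1))) (Icc 0 T) := by
    apply ContinuousOn.mul continuousOn_const
    apply ContinuousOn.mul continuousOn_const
    apply ContinuousOn.rpow_const (by fun_prop)
    intro x hx; have := hx.1; left; positivity
  have hzle : ∀ s ∈ Icc 0 T, z s ≤ z T + ∫ τ in s..T, h τ * (z τ - F τ) := by
    intro s hs
    have hsub : uIcc s T ⊆ Icc 0 T := by rw [uIcc_of_le hs.2]; exact Icc_subset_Icc_left hs.1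
    have e1 := intervalIntegral.integral_eq_sub_of_hasDerivAt (fun t ht => hd t (hsub ht))
      ((hdc.mono hsub).intervalIntegrable)
    have i2 : IntervalIntegrable (fun τ => h τ * (z τ - F τ)) volume s T :=
      ((hhc.mul (hzc.sub hFc)).mono hsub).intervalIntegrable
    have e2 : -∫ τ in s..T, h τ * (z τ - F τ) ≤ ∫ τ in s..T, Q * (-ρ * (1 + τ) ^ (-ρ - 1)) := by
      rw [← intervalIntegral.integral_neg]
      apply intervalIntegral.integral_mono_on hs.2 i2.neg ((hdc.mono hsub).intervalIntegrable)
      intro x hx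
      have hx0 : 0 ≤ x := hs.1.trans hx.1
      have hx1 : 0 < 1 + x := by positivity
      have hFx := hF x ⟨hx0, hx.2⟩
      have e3 : (1 + x) ^ (-ρ - 1) = (1 + x) ^ (-ρ) / (1 + x) := by
        rw [Real.rpow_sub hx1, Real.rpow_one]
      have e4 : 0 < (1 + x) ^ (-ρ) := Real.rpow_pos_of_pos hx1 _
      change -(2 * (κ / (1 + x)) * (P + Q * (1 + x) ^ (-ρ) - F x)) ≤ _
      rw [e3]
      have h5 : κ / (1 + x) * (F x - P - Q * (1 + x) ^ (-ρ)) ≤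
          κ / (1 + x) * (- (Q / 2 * (1 + x) ^ (-ρ))) := by gcongr; linarith
      have h6 : ρ * (Q * (1 + x) ^ (-ρ) / (1 + x)) ≤ κ * (Q * (1 + x) ^ (-ρ) / (1 + x)) := by
        gcongr
      have h7 : κ / (1 + x) * (- (Q / 2 * (1 + x) ^ (-ρ))) =
        - (κ * (Q * (1 + x) ^ (-ρ) / (1 + x))) / 2 := by ring
      have h8 : Q * (-ρ * ((1 + x) ^ (-ρ) / (1 + x))) = - (ρ * (Q * (1 + x) ^ (-ρ) / (1 + x))) := by
        ring
      rw [h8]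
      nlinarith
    linarith
  have hyi : ∀ s ∈ Icc 0 T, IntervalIntegrable y volume s T :=
    fun s hs => intervalIntegrable_of_bounded hm hb hs.1 hs.2
  have hwi : ∀ s ∈ Icc 0 T, IntervalIntegrable (fun τ => h τ * (y τ - z τ)) volume s T := by
    intro s hs
    have hsub : uIcc s T ⊆ Icc 0 T := by rw [uIcc_of_le hs.2]; exact Icc_subset_Icc_left hs.1
    exact ((hyi s hs).sub (hzc.mono hsub).intervalIntegrable).continuousOn_mul (hhc.mono hsub)
  have hsplit : ∀ s ∈ Icc 0 T, ∫ τ in s..T, h τ * (y τ - z τ) =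
      (∫ τ in s..T, h τ * (y τ - F τ)) - ∫ τ in s..T, h τ * (z τ - F τ) := by
    intro s hs
    have hsub : uIcc s T ⊆ Icc 0 T := by rw [uIcc_of_le hs.2]; exact Icc_subset_Icc_left hs.1
    rw [← intervalIntegral.integral_sub]
    · congr 1; ext τ; ring
    · exact ((hyi s hs).sub (hFc.mono hsub).intervalIntegrable).continuousOn_mul (hhc.mono hsub)
    · exact ((hhc.mul (hzc.sub hFc)).mono hsub).intervalIntegrable
  have key := nonpos_of_energy (w := fun t => y t - z t) (h := h) hT
    (fun τ hτ => by have := hτ.1; simp only [hh]; positivity) (hwi 0 ⟨le_rfl, hT⟩) ?_ ?_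
  · simpa [hz] using key
  · have h1 := hzle 0 ⟨le_rfl, hT⟩
    have h2 := hsplit 0 ⟨le_rfl, hT⟩
    have h3 := hE.zero T hT
    have h4 : z 0 = P + Q := by simp [hz]
    simp only [hh] at *
    linarith
  · filter_upwards [hE.ae, ae_restrict_mem measurableSet_Ici] with s hs1 hs2 hs3
    have h1 := hzle s ⟨hs2, hs3⟩
    have h2 := hsplit s ⟨hs2, hs3⟩
    have h3 := hs1 T hs3
    simp only [hh] at *
    linarith

/-- Take M to be the supremum of f, which is finite by the a priori bound. -/
theorem le_two_mul_of_absorb {f : ℝ → ℝ} {T C : ℝ} (hbdd : BddAbove (f '' Icc 0 T))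
    (h : ∀ M, (∀ t ∈ Icc 0 T, f t ≤ M) → ∀ t ∈ Icc 0 T, f t ≤ C + M / 2) :
    ∀ t ∈ Icc 0 T, f t ≤ 2 * C := by
  intro t ht
  have h1 := h (sSup (f '' Icc 0 T)) (fun s hs => le_csSup hbdd ⟨s, hs, rfl⟩)
  have h2 : sSup (f '' Icc 0 T) ≤ C + sSup (f '' Icc 0 T) / 2 := by
    refine csSup_le (Set.Nonempty.image f ⟨t, ht⟩) ?_
    rintro _ ⟨s, hs, rfl⟩
    exact h1 s hs
  have := h1 t ht
  linarith

/-! ### From the split energy inequality to algebraic decay -/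

/-- The low-frequency error term: contributions of the initial value and of the nonlinearity. -/
noncomputable def splitError (K κ r σ : ℝ) (y : ℝ → ℝ) (t : ℝ) : ℝ :=
  K * ((κ / (1 + t)) ^ r + (κ / (1 + t)) ^ (1 + σ) * (∫ τ in (0 : ℝ)..t, y τ) ^ 2)

theorem div_one_add_rpow {κ t s : ℝ} (hκ : 0 ≤ κ) (ht : 0 ≤ t) :
    (κ / (1 + t)) ^ s = κ ^ s * (1 + t) ^ (-s) := by
  rw [Real.div_rpow hκ (by positivity), Real.rpow_neg (by positivity), div_eq_mul_inv]

theorem continuousOn_splitError {K κ r σ E : ℝ} {y : ℝ → ℝ} (hκ : 0 < κ)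
    (hm : AEStronglyMeasurable y (volume.restrict (Ici (0 : ℝ))))
    (hb : ∀ t, 0 ≤ t → 0 ≤ y t ∧ y t ≤ E) {T : ℝ} (hT : 0 ≤ T) :
    ContinuousOn (splitError K κ r σ y) (Icc 0 T) := by
  have h1 : ContinuousOn (fun t : ℝ => κ / (1 + t)) (Icc 0 T) := by
    apply ContinuousOn.div continuousOn_const (by fun_prop)
    intro x hx; have := hx.1; positivity
  have h2 : ∀ x ∈ Icc 0 T, κ / (1 + x) ≠ 0 := by
    intro x hx; have := hx.1; positivity
  have h3 : ContinuousOn (fun t : ℝ => ∫ τ in (0 : ℝ)..t, y τ) (Icc 0 T) := by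
    have h4 := intervalIntegrable_of_bounded hm hb le_rfl hT
    rw [intervalIntegrable_iff_integrableOn_Icc_of_le hT, ← uIcc_of_le hT] at h4
    have := intervalIntegral.continuousOn_primitive_interval h4
    rwa [uIcc_of_le hT] at this
  exact continuousOn_const.mul ((h1.rpow_const fun x hx => Or.inl (h2 x hx)).add
    ((h1.rpow_const fun x hx => Or.inl (h2 x hx)).mul (h3.pow 2)))

theorem integral_le_of_forall_le {y : ℝ → ℝ} {E : ℝ}
    (hm : AEStronglyMeasurable y (volume.restrict (Ici (0 : ℝ))))
    (hb : ∀ t, 0 ≤ t → 0 ≤ y t ∧ y t ≤ E) {a b c : ℝ} (ha : 0 ≤ a) (hab : a ≤ b)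
    (h : ∀ t ∈ Icc a b, y t ≤ c) : ∫ τ in a..b, y τ ≤ c * (b - a) := by
  have := intervalIntegral.integral_mono_on hab (intervalIntegrable_of_bounded hm hb ha hab)
    (_root_.intervalIntegrable_const (c := c)) h
  simpa [mul_comm] using this

theorem integral_nonneg_of_bounded {y : ℝ → ℝ} {E : ℝ}
    (hb : ∀ t, 0 ≤ t → 0 ≤ y t ∧ y t ≤ E) {t : ℝ} (ht : 0 ≤ t) : 0 ≤ ∫ τ in (0 : ℝ)..t, y τ :=
  intervalIntegral.integral_nonneg ht fun τ hτ => (hb τ hτ.1).1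

theorem integral_le_of_le_rpow {y : ℝ → ℝ} {E : ℝ}
    (hm : AEStronglyMeasurable y (volume.restrict (Ici (0 : ℝ))))
    (hb : ∀ t, 0 ≤ t → 0 ≤ y t ∧ y t ≤ E) {M ρ t : ℝ} (hM : 0 ≤ M) (hρ : ρ ≤ 1 / 2) (ht : 0 ≤ t)
    (h : ∀ s ∈ Icc 0 t, y s ≤ M * (1 + s) ^ (-ρ)) :
    ∫ τ in (0 : ℝ)..t, y τ ≤ 2 * M * (1 + t) ^ (1 - ρ) := by
  have hd : ∀ s ∈ uIcc 0 t, HasDerivAt (fun s => 2 * M * (1 + s) ^ (1 - ρ))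
      (2 * M * ((1 - ρ) * (1 + s) ^ (-ρ))) s := by
    intro s hs
    rw [uIcc_of_le ht] at hs
    have h1 : HasDerivAt (fun t : ℝ => (1 + t)) 1 s := (hasDerivAt_id s).const_add 1
    have := (h1.rpow_const (p := 1 - ρ) (Or.inl (by have := hs.1; positivity)))
    simpa using this.const_mul (2 * M)
  have hc : ContinuousOn (fun s => 2 * M * ((1 - ρ) * (1 + s) ^ (-ρ))) (uIcc 0 t) := by
    rw [uIcc_of_le ht]
    apply ContinuousOn.mul continuousOn_const
    apply ContinuousOn.mul continuousOn_const
    apply ContinuousOn.rpow_const (by fun_prop)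
    intro x hx; have := hx.1; left; positivity
  have e := intervalIntegral.integral_eq_sub_of_hasDerivAt hd hc.intervalIntegrable
  have e2 := intervalIntegral.integral_mono_on ht (intervalIntegrable_of_bounded hm hb le_rfl ht)
    hc.intervalIntegrable (fun s hs => by
      -- Here ρ ≤ 1/2 gives 2(1 - ρ) ≥ 1, which accounts for the constant 2.
      refine (h s hs).trans ?_
      have : 0 ≤ (1 + s) ^ (-ρ) := Real.rpow_nonneg (by linarith [hs.1]) _
      have : 0 ≤ M * (1 + s) ^ (-ρ) := by positivity
      nlinarith)
  rw [e] at e2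
  have : (0 : ℝ) ≤ 2 * M * (1 + 0) ^ (1 - ρ) := by simp; positivity
  linarith

variable {σ r E C₁ : ℝ} {K : ℝ → ℝ}

/-- Small κ makes the non-decaying part of F, of size C₁κ²E², at most ε/2. The rest decays, at the
slow rate min(r, κ), so y ≤ ε from some time T on that does not depend on y. It matters that `K κ`
stays bounded as κ tends to 0. -/
theorem exists_integral_le (hσ : 1 ≤ σ) (hr : 0 < r) (hE : 0 ≤ E)
    (hK : ∀ κ, 0 < κ → 0 < K κ) (hK₁ : ∀ κ, 0 < κ → κ ≤ 1 → K κ ≤ C₁) {ε : ℝ} (hε : 0 < ε) :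
    ∃ B, 0 < B ∧ ∀ y : ℝ → ℝ, AEStronglyMeasurable y (volume.restrict (Ici (0 : ℝ))) →
      (∀ t, 0 ≤ t → 0 ≤ y t ∧ y t ≤ E) →
      (∀ κ, 0 < κ → SplitEnergy E κ (splitError (K κ) κ r σ y) y) →
      ∀ t, 0 ≤ t → ∫ τ in (0 : ℝ)..t, y τ ≤ B + ε * t := by
  have hC₁ : 0 < C₁ := (hK 1 one_pos).trans_le (hK₁ 1 one_pos le_rfl)
  obtain ⟨κ, hκ, hκ1, hκε⟩ : ∃ κ : ℝ, 0 < κ ∧ κ ≤ 1 ∧ C₁ * κ ^ 2 * E ^ 2 ≤ ε / 2 := by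
    set κ := min 1 (ε / (2 * (C₁ * E ^ 2 + 1))) with hκ
    have h0 : 0 < C₁ * E ^ 2 + 1 := by positivity
    have hpos : 0 < κ := by positivity
    refine ⟨κ, hpos, min_le_left _ _, ?_⟩
    have h1 : κ ≤ 1 := min_le_left _ _
    have h2 : κ ≤ ε / (2 * (C₁ * E ^ 2 + 1)) := min_le_right _ _
    rw [le_div_iff₀ (by positivity)] at h2
    have h3 : κ ^ 2 ≤ κ := by nlinarith
    have h4 : 0 ≤ C₁ * E ^ 2 := by positivity
    nlinarith
  set ρ := min r κ with hρ
  have hρ0 : 0 < ρ := lt_min hr hκ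
  have hlim : Filter.Tendsto (fun t : ℝ => (2 * C₁ + E) * (1 + t) ^ (-ρ)) Filter.atTop
      (nhds ((2 * C₁ + E) * 0)) := by
    apply Filter.Tendsto.const_mul
    exact (tendsto_rpow_neg_atTop hρ0).comp
      (Filter.tendsto_atTop_add_const_left _ _ Filter.tendsto_id)
  rw [mul_zero] at hlim
  obtain ⟨T₀, hT₀⟩ := Filter.eventually_atTop.1 (hlim.eventually (ge_mem_nhds (half_pos hε)))
  set T := max T₀ 0 with hT
  have hT0 : 0 ≤ T := le_max_right _ _
  refine ⟨E * T + 1, by positivity, fun y hm hb hy t ht => ?_⟩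
  have hyt : ∀ t, 0 ≤ t → y t ≤ C₁ * κ ^ 2 * E ^ 2 + (2 * C₁ + E) * (1 + t) ^ (-ρ) := by
    intro t ht
    refine (hy κ hκ).le hm hb hκ.le (min_le_right _ _) (by positivity) ht
      (continuousOn_splitError hκ hm hb ht) ?_
      (by nlinarith [show 0 ≤ C₁ * κ ^ 2 * E ^ 2 by positivity])
    intro s hs
    have hs0 : 0 ≤ s := hs.1
    have hs1 : 0 < 1 + s := by positivity
    have hY0 := integral_nonneg_of_bounded hb hs.1
    have hY : ∫ τ in (0 : ℝ)..s, y τ ≤ E * (1 + s) := by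
      refine (integral_le_of_forall_le hm hb le_rfl hs.1 fun τ hτ => (hb τ hτ.1).2).trans ?_
      gcongr; linarith
    have hq : κ / (1 + s) ≤ 1 := by rw [div_le_one hs1]; linarith
    have hq0 : 0 < κ / (1 + s) := by positivity
    -- Since σ ≥ 1, the power (1 + s)^(-2) cancels the growth of (∫ y)² ≤ E²(1 + s)² and leaves the
    -- constant P.
    have h1 : (κ / (1 + s)) ^ (1 + σ) ≤ (κ / (1 + s)) ^ 2 := by
      rw [← Real.rpow_natCast]
      exact Real.rpow_le_rpow_of_exponent_ge hq0 hq (by push_cast; linarith)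
    have h2 : (κ / (1 + s)) ^ r ≤ (1 + s) ^ (-ρ) := by
      rw [div_one_add_rpow hκ.le hs0]
      calc κ ^ r * (1 + s) ^ (-r) ≤ 1 * (1 + s) ^ (-ρ) := by
            gcongr
            · exact Real.rpow_le_one hκ.le hκ1 hr.le
            · linarith
            · exact min_le_left _ _
        _ = _ := one_mul _
    calc splitError (K κ) κ r σ y s
        ≤ C₁ * ((1 + s) ^ (-ρ) + (κ / (1 + s)) ^ 2 * (E * (1 + s)) ^ 2) := by
          unfold splitError
          gcongr
          · exact hK₁ κ hκ hκ1
      _ = C₁ * κ ^ 2 * E ^ 2 + C₁ * (1 + s) ^ (-ρ) := by field_simp; ring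
      _ ≤ _ := by
          have : 0 ≤ (1 + s) ^ (-ρ) := by positivity
          nlinarith
  have hyT : ∀ t, T ≤ t → y t ≤ ε := by
    intro t ht
    have h1 := hyt t (hT0.trans ht)
    have h2 := hT₀ t ((le_max_left _ _).trans ht)
    linarith
  have hbE : ∀ a, 0 ≤ a → ∀ τ ∈ Icc 0 a, y τ ≤ E := fun a _ τ hτ => (hb τ hτ.1).2
  rcases le_total t T with h | h
  · have h1 := integral_le_of_forall_le hm hb le_rfl ht (hbE t ht)
    have h2 : E * (t - 0) ≤ E * T := by gcongr; linarith
    have : 0 ≤ ε * t := by positivity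
    linarith
  · have h1 := integral_le_of_forall_le hm hb le_rfl hT0 (hbE T hT0)
    have h2 := integral_le_of_forall_le hm hb hT0 h fun τ hτ => hyT τ hτ.1
    rw [← intervalIntegral.integral_add_adjacent_intervals
      (intervalIntegrable_of_bounded hm hb le_rfl hT0) (intervalIntegrable_of_bounded hm hb hT0 h)]
    have : 0 ≤ ε * T := by positivity
    linarith

theorem splitError_le {κ k : ℝ} (hκ : 0 < κ) (hk : 0 ≤ k) {y : ℝ → ℝ} {t : ℝ} (ht : 0 ≤ t)
    {ρ X : ℝ} (hρ : ρ ≤ r)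
    (hX : (1 + t) ^ (-(1 + σ)) * (∫ τ in (0 : ℝ)..t, y τ) ^ 2 ≤ X * (1 + t) ^ (-ρ)) :
    splitError k κ r σ y t ≤ (k * κ ^ r + k * κ ^ (1 + σ) * X) * (1 + t) ^ (-ρ) := by
  have h1 : 1 ≤ 1 + t := by linarith
  unfold splitError
  rw [div_one_add_rpow hκ.le ht, div_one_add_rpow hκ.le ht]
  calc _ = k * κ ^ r * (1 + t) ^ (-r) +
        k * κ ^ (1 + σ) * ((1 + t) ^ (-(1 + σ)) * (∫ τ in (0 : ℝ)..t, y τ) ^ 2) := by ring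
    _ ≤ k * κ ^ r * (1 + t) ^ (-ρ) + k * κ ^ (1 + σ) * (X * (1 + t) ^ (-ρ)) := by
        gcongr
    _ = _ := by ring

/-- Write (∫ y)² as a product: one factor is at most B + εs, the other is estimated by E(1 + s)
against B and by the weighted supremum M of y against εs. Thus M enters with a small coefficient and
can be absorbed. -/
theorem exists_slow_decay (hσ : 1 ≤ σ) (hr : 0 < r) (hE : 0 ≤ E)
    (hK : ∀ κ, 0 < κ → 0 < K κ) (hK₁ : ∀ κ, 0 < κ → κ ≤ 1 → K κ ≤ C₁) :
    ∃ M, 0 ≤ M ∧ ∀ y : ℝ → ℝ, AEStronglyMeasurable y (volume.restrict (Ici (0 : ℝ))) →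
      (∀ t, 0 ≤ t → 0 ≤ y t ∧ y t ≤ E) →
      (∀ κ, 0 < κ → SplitEnergy E κ (splitError (K κ) κ r σ y) y) →
      ∀ t, 0 ≤ t → y t ≤ M * (1 + t) ^ (-(min r (1 / 2))) := by
  set κ := r + 1 with hκ'
  have hκ : 0 < κ := by positivity
  set ρ := min r (1 / 2) with hρ
  have hρr : ρ ≤ r := min_le_left _ _
  have hρ2 : ρ ≤ 1 / 2 := min_le_right _ _
  have hρ0 : 0 < ρ := lt_min hr (by norm_num)
  have hk := hK κ hκ
  set k := K κ
  set A := k * κ ^ (1 + σ) with hA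
  have hA0 : 0 < A := by positivity
  -- With ε = 1/(8A) the term Aε · 2M equals M/4, half of the M/2 that the absorption allows;
  -- `SplitEnergy.le` needs exactly this half.
  obtain ⟨B, hB, hBy⟩ := exists_integral_le hσ hr hE hK hK₁ (ε := 1 / (8 * A)) (by positivity)
  set D := k * κ ^ r + A * (B * E) with hD
  have hD0 : 0 < D := by positivity
  refine ⟨2 * (E + 2 * D), by positivity, fun y hm hb hy t ht => ?_⟩
  have habs := le_two_mul_of_absorb (f := fun s => y s * (1 + s) ^ ρ) (T := t) (C := E + 2 * D)
    ?_ ?_ t ⟨ht, le_rfl⟩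
  · have h1 : 0 < (1 + t) ^ ρ := by positivity
    rw [Real.rpow_neg (by positivity), ← div_eq_mul_inv, le_div_iff₀ h1]
    exact habs
  · refine ⟨E * (1 + t) ^ ρ, ?_⟩
    rintro _ ⟨s, hs, rfl⟩
    have := hs.1
    have := (hb s hs.1).2
    dsimp only
    gcongr
    exact hs.2
  · intro M hM T hT
    have hM0 : 0 ≤ M := by
      have h1 := hM 0 ⟨le_rfl, ht⟩
      simp only [add_zero, Real.one_rpow, mul_one] at h1
      exact (hb 0 le_rfl).1.trans h1
    have hyM : ∀ s ∈ Icc 0 t, y s ≤ M * (1 + s) ^ (-ρ) := by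
      intro s hs
      have hs0 := hs.1
      have h1 : 0 < (1 + s) ^ ρ := by positivity
      rw [Real.rpow_neg (by positivity), ← div_eq_mul_inv, le_div_iff₀ h1]
      exact hM s hs
    have key := (hy κ hκ).le hm hb hκ.le (ρ := ρ) (P := 0) (Q := E + 2 * D + M / 2) (by linarith)
      (by positivity) hT.1 (continuousOn_splitError hκ hm hb hT.1) ?_ (by linarith)
    · have hT0 := hT.1
      have h1 : 0 < (1 + T) ^ ρ := by positivity
      rw [Real.rpow_neg (by positivity), ← div_eq_mul_inv, zero_add, le_div_iff₀ h1] at key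
      exact key
    · intro s hs
      have hs0 : 0 ≤ s := hs.1
      have hs1 : 0 < 1 + s := by positivity
      have hY0 := integral_nonneg_of_bounded hb hs.1
      have hY1 : ∫ τ in (0 : ℝ)..s, y τ ≤ E * (1 + s) := by
        refine (integral_le_of_forall_le hm hb le_rfl hs.1 fun τ hτ => (hb τ hτ.1).2).trans ?_
        gcongr; linarith
      have hY2 := hBy y hm hb hy s hs0
      have hY3 := integral_le_of_le_rpow hm hb hM0 hρ2 hs0
        fun τ hτ => hyM τ ⟨hτ.1, hτ.2.trans (hs.2.trans hT.2)⟩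
      set Y := ∫ τ in (0 : ℝ)..s, y τ
      have hX : (1 + s) ^ (-(1 + σ)) * Y ^ 2 ≤ (B * E + M / (4 * A)) * (1 + s) ^ (-ρ) := by
        have e1 : (1 + s) ^ (-(1 + σ)) ≤ (1 + s) ^ (-2 : ℝ) :=
          Real.rpow_le_rpow_of_exponent_le (by linarith) (by linarith)
        have e2 : Y ^ 2 ≤ B * E * (1 + s) + M / (4 * A) * (1 + s) ^ (2 - ρ) := by
          have e3 : (1 + s) ^ (2 - ρ) = (1 + s) * (1 + s) ^ (1 - ρ) := by
            rw [show (2 : ℝ) - ρ = 1 + (1 - ρ) by ring, Real.rpow_add hs1, Real.rpow_one]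
          calc Y ^ 2 = Y * Y := by ring
            _ ≤ (B + 1 / (8 * A) * s) * Y := by gcongr
            _ = B * Y + 1 / (8 * A) * s * Y := by ring
            _ ≤ B * (E * (1 + s)) + 1 / (8 * A) * (1 + s) * (2 * M * (1 + s) ^ (1 - ρ)) := by
                gcongr; linarith
            _ = _ := by rw [e3]; field_simp; ring
        calc (1 + s) ^ (-(1 + σ)) * Y ^ 2
            ≤ (1 + s) ^ (-2 : ℝ) * (B * E * (1 + s) + M / (4 * A) * (1 + s) ^ (2 - ρ)) := by gcongr
          _ = B * E * (1 + s) ^ (-1 : ℝ) + M / (4 * A) * (1 + s) ^ (-ρ) := by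
              rw [show (-1 : ℝ) = -2 + 1 by norm_num, show -ρ = -2 + (2 - ρ) by ring,
                Real.rpow_add hs1, Real.rpow_add hs1, Real.rpow_one]
              ring
          _ ≤ B * E * (1 + s) ^ (-ρ) + M / (4 * A) * (1 + s) ^ (-ρ) := by
              gcongr <;> linarith
          _ = _ := by ring
      refine (splitError_le hκ hk.le hs0 hρr hX).trans ?_
      have : k * κ ^ r + k * κ ^ (1 + σ) * (B * E + M / (4 * A)) = D + M / 4 := by
        rw [← hA, hD]; field_simp; ring
      rw [this, zero_add]
      gcongr
      linarith

theorem exists_decay (hσ : 1 ≤ σ) (hr : 0 < r) (hrσ : r ≤ σ) (hE : 0 ≤ E)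
    (hK : ∀ κ, 0 < κ → 0 < K κ) (hK₁ : ∀ κ, 0 < κ → κ ≤ 1 → K κ ≤ C₁) :
    ∃ C, 0 < C ∧ ∀ y : ℝ → ℝ, AEStronglyMeasurable y (volume.restrict (Ici (0 : ℝ))) →
      (∀ t, 0 ≤ t → 0 ≤ y t ∧ y t ≤ E) →
      (∀ κ, 0 < κ → SplitEnergy E κ (splitError (K κ) κ r σ y) y) →
      ∀ t, 0 ≤ t → y t ≤ C * (1 + t) ^ (-r) := by
  obtain ⟨M, hM, hMy⟩ := exists_slow_decay hσ hr hE hK hK₁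
  set κ := r + 1 with hκ'
  have hκ : 0 < κ := by positivity
  have hk := hK κ hκ
  set k := K κ
  set D := k * κ ^ r + k * κ ^ (1 + σ) * (4 * M ^ 2) with hD
  have hD0 : 0 < D := by positivity
  refine ⟨E + 2 * D, by positivity, fun y hm hb hy t ht => ?_⟩
  have key := (hy κ hκ).le hm hb hκ.le (ρ := r) (P := 0) (Q := E + 2 * D) (by linarith)
      (by positivity) ht (continuousOn_splitError hκ hm hb ht) ?_ (by linarith)
  · simpa using key
  · intro s hs
    have hs0 : 0 ≤ s := hs.1
    have hs1 : 0 < 1 + s := by positivity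
    have hY0 := integral_nonneg_of_bounded hb hs.1
    have hY := integral_le_of_le_rpow hm hb hM (min_le_right _ _) hs0
        fun τ hτ => hMy y hm hb hy τ hτ.1
    set Y := ∫ τ in (0 : ℝ)..s, y τ
    set ρ := min r (1 / 2) with hρ
    have hX : (1 + s) ^ (-(1 + σ)) * Y ^ 2 ≤ (4 * M ^ 2) * (1 + s) ^ (-r) := by
      calc (1 + s) ^ (-(1 + σ)) * Y ^ 2
          ≤ (1 + s) ^ (-(1 + σ)) * (2 * M * (1 + s) ^ (1 - ρ)) ^ 2 := by gcongr
        _ = 4 * M ^ 2 * (1 + s) ^ (-(1 + σ) + (1 - ρ) + (1 - ρ)) := by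
            rw [Real.rpow_add hs1, Real.rpow_add hs1]; ring
        _ ≤ _ := by
            gcongr
            · linarith
            -- The exponent is 1 - σ - 2ρ. It is at most -r by σ ≥ 1 if ρ = r, and by r ≤ σ if ρ =
            -- 1/2.
            · rcases min_choice r (1 / 2) with h | h <;> rw [hρ, h] <;> linarith
    refine (splitError_le hκ hk.le hs0 le_rfl hX).trans ?_
    rw [← hD, zero_add]
    gcongr
    linarith

/-! ### L² duality, frequency cutoffs and multipliers -/

theorem integrable_norm_mul_norm {F G : Type*} [NormedAddCommGroup F] [NormedAddCommGroup G]
    {f : Plane → F} {g : Plane → G} (hf : MemLp f 2) (hg : MemLp g 2) :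
    Integrable (fun x => ‖f x‖ * ‖g x‖) :=
  hf.norm.integrable_mul hg.norm

theorem integral_norm_mul_norm_le {F G : Type*} [NormedAddCommGroup F] [NormedAddCommGroup G]
    {f : Plane → F} {g : Plane → G} (hf : MemLp f 2) (hg : MemLp g 2) :
    ∫ x, ‖f x‖ * ‖g x‖ ≤ ‖hf.toLp f‖ * ‖hg.toLp g‖ := by
  have h := real_inner_le_norm (hg.norm.toLp _) (hf.norm.toLp _)
  rw [L2.inner_def] at h
  have e : ∫ x, inner ℝ (hg.norm.toLp _ x) (hf.norm.toLp _ x) = ∫ x, ‖f x‖ * ‖g x‖ := by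
    apply integral_congr_ae
    filter_upwards [hf.norm.coeFn_toLp, hg.norm.coeFn_toLp] with x h1 h2
    rw [h1, h2]; simp
  rw [e] at h
  simp only [Lp.norm_toLp, eLpNorm_norm] at h ⊢
  linarith

theorem integral_norm_mul_norm_le_Lp {F G : Type*} [NormedAddCommGroup F] [NormedAddCommGroup G]
    (f : Lp F 2 (volume : Measure Plane)) (g : Lp G 2 (volume : Measure Plane)) :
    ∫ x, ‖f x‖ * ‖g x‖ ≤ ‖f‖ * ‖g‖ := by
  simpa using integral_norm_mul_norm_le (Lp.memLp f) (Lp.memLp g)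

theorem norm_toComplex (f : L2R) : ‖toComplex f‖ = ‖f‖ := by
  rw [Lp.norm_def, Lp.norm_def]
  congr 1
  apply eLpNorm_congr_norm_ae
  filter_upwards [ContinuousLinearMap.coeFn_compLp Complex.ofRealCLM f] with x hx
  unfold toComplex
  rw [hx]; simp

theorem toComplex_sub (f g : L2R) : toComplex (f - g) = toComplex f - toComplex g :=
  map_sub (Complex.ofRealCLM.compLpₗ 2 (volume : Measure Plane)) f g

theorem pairing_eq_inner (f : L2R) (g : L2C) : pairing f g = inner ℂ (toComplex f) g := by
  rw [L2.inner_def]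
  apply integral_congr_ae
  filter_upwards [ContinuousLinearMap.coeFn_compLp Complex.ofRealCLM f] with x hx
  unfold toComplex
  rw [hx]; simp [mul_comm]

theorem pairing_fourierInv (f : L2R) (g : L2C) :
    pairing f (𝓕⁻ g : L2C) = inner ℂ (𝓕 (toComplex f) : L2C) g := by
  rw [pairing_eq_inner, ← Lp.inner_fourier_eq, FourierTransform.fourier_fourierInv_eq]

/-- An `L²` function is controlled by its pairings with Schwartz functions. -/
theorem norm_le_of_forall_schwartz {x : L2C} {B : ℝ} (hB : 0 ≤ B)
    (h : ∀ ψ : 𝓢(Plane, ℂ), ‖inner ℂ x (ψ.toLp 2)‖ ≤ B * ‖ψ.toLp 2‖) : ‖x‖ ≤ B := by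
  have key : ∀ y : L2C, ‖inner ℂ x y‖ ≤ B * ‖y‖ := by
    intro y
    refine DenseRange.induction_on (p := fun y : L2C => ‖inner ℂ x y‖ ≤ B * ‖y‖)
      (SchwartzMap.denseRange_toLpCLM (E := Plane) (F := ℂ) (p := 2) (μ := volume)
        ENNReal.ofNat_ne_top) y ?_ ?_
    · exact isClosed_le (by fun_prop) (by fun_prop)
    · exact h
  have := key x
  rw [inner_self_eq_norm_sq_to_K] at this
  rcases eq_or_lt_of_le (norm_nonneg x) with h0 | h0
  · rw [← h0]; exact hB
  · simp at this
    nlinarith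

theorem memLp_cutoff (η : 𝓢(Plane, ℝ)) (f : L2C) :
    MemLp (fun ξ => (η ξ : ℂ) * f ξ) 2 (volume : Measure Plane) := by
  obtain ⟨C, -, hC⟩ := η.decay 0 0
  refine (Lp.memLp f).of_le_mul (c := C) ?_ ?_
  · exact (Complex.continuous_ofReal.comp η.continuous).aestronglyMeasurable.mul
      (Lp.aestronglyMeasurable f)
  · refine Filter.Eventually.of_forall fun ξ => ?_
    have := hC ξ
    simp only [pow_zero, norm_iteratedFDeriv_zero, one_mul] at this
    rw [norm_mul, Complex.norm_real]
    gcongr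

/-- Multiplication by a Schwartz function on `L²`. -/
noncomputable def cutoff (η : 𝓢(Plane, ℝ)) (f : L2C) : L2C := (memLp_cutoff η f).toLp _

theorem coeFn_cutoff (η : 𝓢(Plane, ℝ)) (f : L2C) :
    cutoff η f =ᵐ[volume] fun ξ => (η ξ : ℂ) * f ξ := (memLp_cutoff η f).coeFn_toLp

theorem cutoff_sub (η : 𝓢(Plane, ℝ)) (f g : L2C) : cutoff η (f - g) = cutoff η f - cutoff η g := by
  apply Lp.ext
  filter_upwards [coeFn_cutoff η (f - g), coeFn_cutoff η f, coeFn_cutoff η g, Lp.coeFn_sub f g,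
    Lp.coeFn_sub (cutoff η f) (cutoff η g)] with ξ h1 h2 h3 h4 h5
  rw [h1, h5, Pi.sub_apply, h2, h3, h4, Pi.sub_apply]; ring

theorem norm_cutoff_le {η : 𝓢(Plane, ℝ)} (h0 : ∀ ξ, 0 ≤ η ξ) (h1 : ∀ ξ, η ξ ≤ 1) (f : L2C) :
    ‖cutoff η f‖ ≤ ‖f‖ := by
  apply Lp.norm_le_norm_of_ae_le
  filter_upwards [coeFn_cutoff η f] with ξ h
  rw [h, norm_mul, Complex.norm_real, Real.norm_of_nonneg (h0 ξ)]
  exact mul_le_of_le_one_left (norm_nonneg _) (h1 ξ)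

/-- The product of two Schwartz functions. -/
noncomputable def schwartzMul (η : 𝓢(Plane, ℝ)) (ψ : 𝓢(Plane, ℂ)) : 𝓢(Plane, ℂ) :=
  SchwartzMap.smulLeftCLM ℂ (fun ξ => η ξ) ψ

theorem schwartzMul_apply (η : 𝓢(Plane, ℝ)) (ψ : 𝓢(Plane, ℂ)) (ξ : Plane) :
    schwartzMul η ψ ξ = (η ξ : ℂ) * ψ ξ := by
  unfold schwartzMul
  rw [SchwartzMap.smulLeftCLM_apply_apply η.hasTemperateGrowth]; simp

theorem inner_cutoff (η : 𝓢(Plane, ℝ)) (f : L2C) (ψ : 𝓢(Plane, ℂ)) :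
    inner ℂ (cutoff η f) (ψ.toLp 2) = inner ℂ f ((schwartzMul η ψ).toLp 2) := by
  rw [L2.inner_def, L2.inner_def]
  apply integral_congr_ae
  filter_upwards [coeFn_cutoff η f, ψ.coeFn_toLp 2 volume,
    (schwartzMul η ψ).coeFn_toLp 2 volume] with ξ h1 h2 h3
  rw [h1, h2, h3, schwartzMul_apply]
  simp; ring

theorem integral_norm_schwartzMul_le (η : 𝓢(Plane, ℝ)) (ψ : 𝓢(Plane, ℂ)) :
    ∫ ξ, ‖schwartzMul η ψ ξ‖ ≤
      ‖η.toLp 2 (volume : Measure Plane)‖ * ‖ψ.toLp 2 (volume : Measure Plane)‖ := by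
  have := integral_norm_mul_norm_le (η.memLp 2) (ψ.memLp 2)
  simp only [schwartzMul_apply, norm_mul, Complex.norm_real]
  exact this

theorem norm_fourierInv_le (χ : 𝓢(Plane, ℂ)) (x : Plane) :
    ‖(𝓕⁻ χ : 𝓢(Plane, ℂ)) x‖ ≤ ∫ ξ, ‖χ ξ‖ := by
  rw [SchwartzMap.fourierInv_coe, Real.fourierInv_eq]
  refine (norm_integral_le_integral_norm _).trans (le_of_eq ?_)
  simp

/-- A Bernstein-type bound: differentiation multiplies the transform by 2πiξ_j, and the sup norm is
at most the L¹ norm on the Fourier side. -/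
theorem norm_fderiv_fourierInv_le (χ : 𝓢(Plane, ℂ)) (x : Plane) {b : ℝ} (j : Fin 2)
    (hb : ∀ ξ, χ ξ ≠ 0 → |ξ j| ≤ b) :
    ‖fderiv ℝ (𝓕⁻ χ : 𝓢(Plane, ℂ)) x (EuclideanSpace.single j 1)‖ ≤
      2 * Real.pi * (b * ∫ ξ, ‖χ ξ‖) := by
  rw [← SchwartzMap.lineDerivOp_apply_eq_fderiv, SchwartzMap.lineDerivOp_fourierInv_eq]
  refine (norm_fourierInv_le _ x).trans ?_
  have h : ∀ ξ : Plane, ‖((2 * Real.pi * Complex.I : ℂ) • SchwartzMap.smulLeftCLM ℂ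
      (inner ℝ · (EuclideanSpace.single j (1 : ℝ))) χ) ξ‖ = 2 * Real.pi * (|ξ j| * ‖χ ξ‖) := by
    intro ξ
    have : Function.HasTemperateGrowth
      (fun ξ : Plane => inner ℝ ξ (EuclideanSpace.single j (1 : ℝ))) := by fun_prop
    rw [smul_apply, SchwartzMap.smulLeftCLM_apply_apply this]
    simp [EuclideanSpace.inner_single_right, abs_of_pos Real.pi_pos]
  simp_rw [h]
  rw [integral_const_mul, ← integral_const_mul b]
  have hle : ∀ ξ, |ξ j| * ‖χ ξ‖ ≤ b * ‖χ ξ‖ := by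
    intro ξ
    by_cases h0 : χ ξ = 0
    · simp [h0]
    · gcongr; exact hb ξ h0
  gcongr ?_ * ?_
  refine integral_mono_of_nonneg (Filter.Eventually.of_forall fun ξ => by positivity)
    (χ.integrable.norm.const_mul b) (Filter.Eventually.of_forall hle)

theorem norm_multiplier_le {σ : Plane → ℂ} (hσ : ∀ ξ, ‖σ ξ‖ ≤ 1) (f : L2C) :
    ‖multiplier σ f‖ ≤ ‖f‖ := by
  unfold multiplier
  split_ifs with h
  · rw [← Lp.norm_fourier_eq, FourierTransform.fourier_fourierInv_eq, ← Lp.norm_fourier_eq f]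
    apply Lp.norm_le_norm_of_ae_le
    filter_upwards [h.coeFn_toLp] with ξ hξ
    rw [hξ, norm_mul]
    exact mul_le_of_le_one_left (norm_nonneg _) (hσ ξ)
  · simp

theorem norm_velocitySymbol_le (j : Fin 2) (ξ : Plane) : ‖velocitySymbol j ξ‖ ≤ 1 := by
  have h : ∀ i : Fin 2, |ξ i| / ‖ξ‖ ≤ 1 := fun i =>
    div_le_one_of_le₀ (by simpa using PiLp.norm_apply_le ξ i) (norm_nonneg _)
  unfold velocitySymbol
  split_ifs
  · simpa using h 1
  · simpa using h 0

theorem norm_velocity_le (f : L2R) (j : Fin 2) : ‖velocity f j‖ ≤ ‖f‖ :=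
  (norm_multiplier_le (norm_velocitySymbol_le j) _).trans (norm_toComplex f).le

/-! ### Estimates for low-pass test functions -/

/-- A smooth frequency cutoff that is equal to `1` where `m` is below `g`. -/
structure IsLowPass (m : Plane → ℝ) (g b v : ℝ) (η : 𝓢(Plane, ℝ)) : Prop where
  nonneg : ∀ ξ, 0 ≤ η ξ
  le_one : ∀ ξ, η ξ ≤ 1
  high : ∀ ξ, g * (1 - η ξ ^ 2) ≤ m ξ
  low : ∀ ξ, η ξ ≠ 0 → m ξ ≤ 8 * g
  freq : ∀ ξ j, η ξ ≠ 0 → |ξ j| ≤ b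
  mass : ‖η.toLp 2 (volume : Measure Plane)‖ ≤ v

/-- The norm of the low-frequency part. -/
noncomputable def lowNorm (η : 𝓢(Plane, ℝ)) (f : L2R) : ℝ := ‖cutoff η (𝓕 (toComplex f))‖

section LowPass

variable {m : Plane → ℝ} {g b v : ℝ} {η : 𝓢(Plane, ℝ)}

theorem IsLowPass.lowNorm_le (h : IsLowPass m g b v η) (f : L2R) : lowNorm η f ≤ ‖f‖ := by
  refine (norm_cutoff_le h.nonneg h.le_one _).trans ?_
  rw [Lp.norm_fourier_eq, norm_toComplex]

theorem IsLowPass.continuous_lowNorm (h : IsLowPass m g b v η) : Continuous (lowNorm η) := by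
  have : LipschitzWith 1 (lowNorm η) := by
    apply LipschitzWith.of_dist_le_mul
    intro f₁ f₂
    rw [Real.dist_eq, dist_eq_norm, NNReal.coe_one, one_mul]
    refine (abs_norm_sub_norm_le _ _).trans ?_
    rw [← cutoff_sub]
    refine (norm_cutoff_le h.nonneg h.le_one _).trans ?_
    have e : (𝓕 (toComplex f₁) - 𝓕 (toComplex f₂) : L2C) = 𝓕 (toComplex (f₁ - f₂)) := by
      rw [toComplex_sub]
      exact (map_sub (Lp.fourierTransformₗᵢ Plane ℂ) _ _).symm
    rw [e, Lp.norm_fourier_eq, norm_toComplex]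
  exact this.continuous

/-- Plancherel, with η real. By duality, bounds on these pairings are bounds on `lowNorm`. -/
theorem pairing_test (η : 𝓢(Plane, ℝ)) (f : L2R) (ψ : 𝓢(Plane, ℂ)) :
    pairing f ((𝓕⁻ (schwartzMul η ψ) : 𝓢(Plane, ℂ)).toLp 2) =
      inner ℂ (cutoff η (𝓕 (toComplex f))) (ψ.toLp 2) := by
  rw [inner_cutoff, ← SchwartzMap.toLp_fourierInv_eq, pairing_fourierInv]

/-- The flux is in L¹ with norm at most ‖f‖² per component, the Riesz transforms being contractions
on L². The gradient of the test function is bounded in sup norm by the frequency bound b and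
Cauchy–Schwarz on the support of η. -/
theorem IsLowPass.norm_transport_le (h : IsLowPass m g b v η) (hb : 0 ≤ b) (f : L2R)
    (ψ : 𝓢(Plane, ℂ)) :
    ‖transport f (𝓕⁻ (schwartzMul η ψ))‖ ≤
      4 * Real.pi * b * v * ‖f‖ ^ 2 * ‖ψ.toLp 2 (volume : Measure Plane)‖ := by
  have key : ∀ j : Fin 2, ‖∫ x : Plane, toComplex f x * velocity f j x *
      fderiv ℝ (𝓕⁻ (schwartzMul η ψ) : 𝓢(Plane, ℂ)) x (EuclideanSpace.single j (1 : ℝ))‖ ≤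
      2 * Real.pi * b * v * ‖f‖ ^ 2 * ‖ψ.toLp 2 (volume : Measure Plane)‖ := by
    intro j
    set S := 2 * Real.pi * (b * (v * ‖ψ.toLp 2 (volume : Measure Plane)‖)) with hS
    have hS' : ∀ x, ‖fderiv ℝ (𝓕⁻ (schwartzMul η ψ) : 𝓢(Plane, ℂ)) x
        (EuclideanSpace.single j (1 : ℝ))‖ ≤ S := by
      intro x
      refine (norm_fderiv_fourierInv_le _ x (b := b) j ?_).trans ?_
      · intro ξ hξ
        refine h.freq ξ j fun h0 => hξ ?_
        rw [schwartzMul_apply, h0]; simp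
      · rw [hS]
        gcongr
        refine (integral_norm_schwartzMul_le η ψ).trans ?_
        gcongr
        exact h.mass
    have hv : 0 ≤ v := (norm_nonneg _).trans h.mass
    have hS0 : 0 ≤ S := by positivity
    calc _ ≤ ∫ x, S * (‖toComplex f x‖ * ‖velocity f j x‖) := by
          refine norm_integral_le_of_norm_le
            ((integrable_norm_mul_norm (Lp.memLp _) (Lp.memLp _)).const_mul S)
            (Filter.Eventually.of_forall fun x => ?_)
          rw [norm_mul, norm_mul, mul_comm]
          gcongr
          exact hS' x
      _ ≤ S * (‖toComplex f‖ * ‖velocity f j‖) := by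
          rw [integral_const_mul]
          gcongr
          exact integral_norm_mul_norm_le_Lp _ _
      _ ≤ S * (‖f‖ * ‖f‖) := by
          gcongr
          · exact (norm_toComplex f).le
          · exact norm_velocity_le f j
      _ = _ := by rw [hS]; ring
  unfold transport
  rw [Fin.sum_univ_two]
  refine (norm_add_le _ _).trans ?_
  linarith [key 0, key 1]

/-- The factor η is moved onto the transform of f, so that `lowNorm η f` appears instead of ‖f‖ and
Gronwall's inequality closes. -/
theorem IsLowPass.norm_pairing_multiplier_le (h : IsLowPass m g b v η) (hm : Measurable m)
    (hm0 : ∀ ξ, 0 ≤ m ξ) (hg : 0 ≤ g) (f : L2R) (ψ : 𝓢(Plane, ℂ)) :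
    ‖pairing f (multiplier (fun ξ => (m ξ : ℂ))
      ((𝓕⁻ (schwartzMul η ψ) : 𝓢(Plane, ℂ)).toLp 2))‖ ≤
      8 * g * lowNorm η f * ‖ψ.toLp 2 (volume : Measure Plane)‖ := by
  set G : L2C := 𝓕 ((𝓕⁻ (schwartzMul η ψ) : 𝓢(Plane, ℂ)).toLp 2) with hG
  have hG' : G =ᵐ[volume] fun ξ => (η ξ : ℂ) * ψ ξ := by
    have : G = (schwartzMul η ψ).toLp 2 := by
      rw [hG, SchwartzMap.toLp_fourier_eq, FourierTransform.fourier_fourierInv_eq]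
    rw [this]
    filter_upwards [(schwartzMul η ψ).coeFn_toLp 2 volume] with ξ hξ
    rw [hξ, schwartzMul_apply]
  have hmG : ∀ᵐ ξ, ‖(m ξ : ℂ) * G ξ‖ ≤ 8 * g * (η ξ * ‖ψ ξ‖) := by
    filter_upwards [hG'] with ξ hξ
    rw [hξ, norm_mul, norm_mul, Complex.norm_real, Complex.norm_real,
      Real.norm_of_nonneg (hm0 ξ), Real.norm_of_nonneg (h.nonneg ξ)]
    by_cases h0 : η ξ = 0
    · simp [h0]
    · have := h.nonneg ξ
      gcongr
      exact h.low ξ h0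
  have hmem : MemLp (fun ξ => (m ξ : ℂ) * G ξ) 2 (volume : Measure Plane) := by
    refine (ψ.memLp 2).of_le_mul (c := 8 * g) ?_ ?_
    · exact (Complex.measurable_ofReal.comp hm).aestronglyMeasurable.mul (Lp.aestronglyMeasurable G)
    · filter_upwards [hmG] with ξ hξ
      refine hξ.trans ?_
      gcongr
      exact mul_le_of_le_one_left (norm_nonneg _) (h.le_one ξ)
  unfold multiplier
  rw [dif_pos hmem, pairing_fourierInv, L2.inner_def]
  have hc := coeFn_cutoff η (𝓕 (toComplex f))
  calc _ ≤ ∫ ξ, 8 * g * (‖cutoff η (𝓕 (toComplex f)) ξ‖ * ‖(ψ.toLp 2 volume) ξ‖) := by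
        refine norm_integral_le_of_norm_le
            ((integrable_norm_mul_norm (Lp.memLp _) (Lp.memLp _)).const_mul _) ?_
        filter_upwards [hc, hmG, hmem.coeFn_toLp, ψ.coeFn_toLp 2 volume] with ξ h1 h2 h3 h4
        refine (norm_inner_le_norm _ _).trans ?_
        rw [h1, h3, h4, norm_mul (η ξ : ℂ), Complex.norm_real, Real.norm_of_nonneg (h.nonneg ξ)]
        calc _ ≤ ‖(𝓕 (toComplex f) : L2C) ξ‖ * (8 * g * (η ξ * ‖ψ ξ‖)) := by gcongr
          _ = _ := by ring
    _ ≤ 8 * g * (lowNorm η f * ‖ψ.toLp 2 (volume : Measure Plane)‖) := by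
        rw [integral_const_mul]
        gcongr
        exact integral_norm_mul_norm_le_Lp _ _
    _ = _ := by ring

end LowPass

/-! ### Low and high frequencies of a weak solution -/

section WeakSolution

variable {m : Plane → ℝ} {g b v : ℝ} {η : 𝓢(Plane, ℝ)} {θ₀ : L2R} {θ : ℝ → L2R}

theorem IsWeakSolution.norm_le (h : IsWeakSolution m θ₀ θ) {t : ℝ} (ht : 0 ≤ t) :
    ‖θ t‖ ≤ ‖θ₀‖ := by
  have h1 : ‖θ t‖ₑ ^ 2 ≤ ‖θ₀‖ₑ ^ 2 := le_self_add.trans (h.energy_zero t ht)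
  have h2 : ‖θ t‖ₑ ≤ ‖θ₀‖ₑ := (ENNReal.pow_le_pow_left_iff two_ne_zero).1 h1
  simpa [enorm_le_iff_norm_le] using h2

theorem IsWeakSolution.intervalIntegrable_norm_sq (h : IsWeakSolution m θ₀ θ) {t : ℝ} (ht : 0 ≤ t) :
    IntervalIntegrable (fun s => ‖θ s‖ ^ 2) volume 0 t :=
  intervalIntegrable_of_bounded (y := fun s => ‖θ s‖ ^ 2) (E := ‖θ₀‖ ^ 2) (h.measurable.norm.pow 2)
    (fun s hs => ⟨by positivity, by gcongr; exact h.norm_le hs⟩) le_rfl ht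

theorem IsWeakSolution.intervalIntegrable_lowNorm (h : IsWeakSolution m θ₀ θ)
    (hη : IsLowPass m g b v η) {t : ℝ} (ht : 0 ≤ t) :
    IntervalIntegrable (fun s => lowNorm η (θ s)) volume 0 t :=
  intervalIntegrable_of_bounded (E := ‖θ₀‖)
    (hη.continuous_lowNorm.comp_aestronglyMeasurable h.measurable)
    (fun _ hs => ⟨norm_nonneg _, (hη.lowNorm_le _).trans (h.norm_le hs)⟩) le_rfl ht

theorem norm_integral_le_mul {f : ℝ → ℂ} {y : ℝ → ℝ} {c N t : ℝ}
    (hy : IntervalIntegrable y volume 0 t) (ht : 0 ≤ t) (h : ∀ s, ‖f s‖ ≤ c * y s * N) :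
    ‖∫ s in (0 : ℝ)..t, f s‖ ≤ c * (∫ s in (0 : ℝ)..t, y s) * N := by
  have := intervalIntegral.norm_integral_le_of_norm_le ht (g := fun s => c * y s * N)
    (Filter.Eventually.of_forall fun s _ => h s) ((hy.const_mul _).mul_const _)
  rwa [intervalIntegral.integral_mul_const, intervalIntegral.integral_const_mul] at this

/-- The equation, tested with low-frequency functions. -/
theorem IsWeakSolution.lowNorm_le_integral (h : IsWeakSolution m θ₀ θ) (hη : IsLowPass m g b v η)
    (hm : Measurable m) (hm0 : ∀ ξ, 0 ≤ m ξ) (hg : 0 ≤ g) (hb : 0 ≤ b) {t : ℝ} (ht : 0 ≤ t) :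
    lowNorm η (θ t) ≤ lowNorm η θ₀ + 4 * Real.pi * b * v * (∫ s in (0 : ℝ)..t, ‖θ s‖ ^ 2)
      + 8 * g * ∫ s in (0 : ℝ)..t, lowNorm η (θ s) := by
  have hv : 0 ≤ v := (norm_nonneg _).trans hη.mass
  have i1 : 0 ≤ ∫ s in (0 : ℝ)..t, ‖θ s‖ ^ 2 :=
    intervalIntegral.integral_nonneg ht fun _ _ => by positivity
  have i2 : 0 ≤ ∫ s in (0 : ℝ)..t, lowNorm η (θ s) :=
    intervalIntegral.integral_nonneg ht fun _ _ => norm_nonneg _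
  have i3 : 0 ≤ lowNorm η θ₀ := norm_nonneg _
  refine norm_le_of_forall_schwartz (by positivity) fun ψ => ?_
  rw [← pairing_test, h.weak_form _ t ht]
  set N := ‖ψ.toLp 2 (volume : Measure Plane)‖ with hN
  have e1 : ‖pairing θ₀ ((𝓕⁻ (schwartzMul η ψ) : 𝓢(Plane, ℂ)).toLp 2)‖ ≤ lowNorm η θ₀ * N := by
    rw [pairing_test]
    exact norm_inner_le_norm _ _
  have e2 : ‖∫ s in (0 : ℝ)..t, transport (θ s) (𝓕⁻ (schwartzMul η ψ))‖ ≤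
      4 * Real.pi * b * v * (∫ s in (0 : ℝ)..t, ‖θ s‖ ^ 2) * N :=
    norm_integral_le_mul (h.intervalIntegrable_norm_sq ht) ht fun s => hη.norm_transport_le hb _ _
  have e3 : ‖∫ s in (0 : ℝ)..t, pairing (θ s) (multiplier (fun ξ => (m ξ : ℂ))
      ((𝓕⁻ (schwartzMul η ψ) : 𝓢(Plane, ℂ)).toLp 2))‖ ≤
      8 * g * (∫ s in (0 : ℝ)..t, lowNorm η (θ s)) * N :=
    norm_integral_le_mul (h.intervalIntegrable_lowNorm hη ht) ht fun s =>
      hη.norm_pairing_multiplier_le hm hm0 hg _ _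
  refine (norm_sub_le _ _).trans ?_
  have := norm_add_le (pairing θ₀ ((𝓕⁻ (schwartzMul η ψ) : 𝓢(Plane, ℂ)).toLp 2))
    (∫ s in (0 : ℝ)..t, transport (θ s) (𝓕⁻ (schwartzMul η ψ)))
  linarith

/-- Gronwall's inequality in integral form, with a non-optimal constant. -/
theorem le_of_le_add_integral {a : ℝ → ℝ} {A c T E : ℝ} (hT : 0 ≤ T) (hA : 0 ≤ A) (hc : 0 < c)
    (hi : IntervalIntegrable a volume 0 T) (hbdd : ∀ t ∈ Icc 0 T, a t ≤ E)
    (hnn : ∀ t ∈ Icc 0 T, 0 ≤ a t)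
    (h : ∀ t ∈ Icc 0 T, a t ≤ A + c * ∫ s in (0 : ℝ)..t, a s) :
    a T ≤ 2 * A * Real.exp (2 * c * T) := by
  -- With the weight exp(-2ct), a bound M contributes at most c · M/(2c) = M/2 through the integral,
  -- which is absorbed.
  have key := le_two_mul_of_absorb (f := fun t => a t * Real.exp (-(2 * c * t))) (T := T) (C := A)
    ?_ ?_ T ⟨hT, le_rfl⟩
  · rwa [Real.exp_neg, ← div_eq_mul_inv, div_le_iff₀ (Real.exp_pos _)] at key
  · refine ⟨E, ?_⟩
    rintro _ ⟨t, ht, rfl⟩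
    have h1 : Real.exp (-(2 * c * t)) ≤ 1 := by
      rw [Real.exp_le_one_iff]
      have := ht.1
      have : 0 ≤ 2 * c * t := by positivity
      linarith
    exact (mul_le_of_le_one_right (hnn t ht) h1).trans (hbdd t ht)
  · intro M hM t ht
    have ht0 := ht.1
    have hM' : ∀ s ∈ Icc 0 t, a s ≤ M * Real.exp (2 * c * s) := by
      intro s hs
      have := hM s ⟨hs.1, hs.2.trans ht.2⟩
      rwa [Real.exp_neg, ← div_eq_mul_inv, div_le_iff₀ (Real.exp_pos _)] at this
    have hM0 : 0 ≤ M := by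
      have := (hnn 0 ⟨le_rfl, hT⟩).trans (hM' 0 ⟨le_rfl, ht.1⟩)
      simpa using this
    have hsub : uIcc 0 t ⊆ uIcc 0 T := by
      rw [uIcc_of_le ht.1, uIcc_of_le hT]; exact Icc_subset_Icc_right ht.2
    have e1 : ∫ s in (0 : ℝ)..t, a s ≤ ∫ s in (0 : ℝ)..t, M * Real.exp (2 * c * s) :=
      intervalIntegral.integral_mono_on ht.1 (hi.mono_set hsub)
        ((by fun_prop : Continuous fun s => M * Real.exp (2 * c * s)).intervalIntegrable _ _) hM'
    have e2 : ∫ s in (0 : ℝ)..t, M * Real.exp (2 * c * s) =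
        M / (2 * c) * Real.exp (2 * c * t) - M / (2 * c) * Real.exp (2 * c * 0) := by
      apply intervalIntegral.integral_eq_sub_of_hasDerivAt
      · intro s _
        have h1 : HasDerivAt (fun s : ℝ => 2 * c * s) (2 * c) s := by
          simpa using (hasDerivAt_id s).const_mul (2 * c)
        have := (h1.exp).const_mul (M / (2 * c))
        refine this.congr_deriv ?_
        field_simp
      · exact (by fun_prop : Continuous fun s => M * Real.exp (2 * c * s)).intervalIntegrable _ _
    have e3 : c * ∫ s in (0 : ℝ)..t, a s ≤ M / 2 * Real.exp (2 * c * t) := by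
      calc c * ∫ s in (0 : ℝ)..t, a s ≤ c * (M / (2 * c) * Real.exp (2 * c * t)) := by
            gcongr
            rw [e2] at e1
            have : 0 ≤ M / (2 * c) * Real.exp (2 * c * 0) := by positivity
            linarith
        _ = _ := by field_simp
    rw [Real.exp_neg, ← div_eq_mul_inv, div_le_iff₀ (Real.exp_pos _)]
    have h1 : 1 ≤ Real.exp (2 * c * t) := Real.one_le_exp (by positivity)
    have h2 := h t ht
    nlinarith

/-- The cutoff is frozen while time runs over [0, T]; the flux integral is nondecreasing in time and
serves as a constant in Gronwall's inequality. -/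
theorem IsWeakSolution.lowNorm_le (h : IsWeakSolution m θ₀ θ) (hη : IsLowPass m g b v η)
    (hm : Measurable m) (hm0 : ∀ ξ, 0 ≤ m ξ) (hg : 0 < g) (hb : 0 ≤ b) {T : ℝ} (hT : 0 ≤ T) :
    lowNorm η (θ T) ≤ 2 * (lowNorm η θ₀ + 4 * Real.pi * b * v * ∫ s in (0 : ℝ)..T, ‖θ s‖ ^ 2) *
      Real.exp (2 * (8 * g) * T) := by
  have hv : 0 ≤ v := (norm_nonneg _).trans hη.mass
  have i1 : 0 ≤ ∫ s in (0 : ℝ)..T, ‖θ s‖ ^ 2 :=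
    intervalIntegral.integral_nonneg hT fun _ _ => by positivity
  have i3 : 0 ≤ lowNorm η θ₀ := norm_nonneg _
  refine le_of_le_add_integral (a := fun t => lowNorm η (θ t)) (E := ‖θ₀‖) hT (by positivity)
    (by positivity) (h.intervalIntegrable_lowNorm hη hT)
    (fun t ht => (hη.lowNorm_le _).trans (h.norm_le ht.1)) (fun _ _ => norm_nonneg _) ?_
  intro t ht
  refine (h.lowNorm_le_integral hη hm hm0 hg.le hb ht.1).trans ?_
  gcongr
  exact intervalIntegral.integral_mono_interval le_rfl ht.1 ht.2
    (Filter.Eventually.of_forall fun s => by positivity) (h.intervalIntegrable_norm_sq hT)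

/-- The low frequencies of a function in `L² ∩ Lᵖ`. -/
theorem IsLowPass.lowNorm_le_of_memLp (hη : IsLowPass m g b v η) {p l : ℝ} (hp : 1 ≤ p)
    (hp2 : p < 2) (hl : 0 < l) (hθ₀ : MemLp θ₀ (ENNReal.ofReal p) (volume : Measure Plane)) :
    lowNorm η θ₀ ≤ v * l ^ (1 - p) * (∫ x, ‖θ₀ x‖ ^ p) +
      l ^ (1 - p / 2) * √(∫ x, ‖θ₀ x‖ ^ p) := by
  have hv : 0 ≤ v := (norm_nonneg _).trans hη.mass
  have hp0 : 0 < p := by linarith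
  have hN : 0 ≤ ∫ x, ‖θ₀ x‖ ^ p := integral_nonneg fun x => by positivity
  have hint : Integrable (fun x => ‖θ₀ x‖ ^ p) := by
    have := hθ₀.integrable_norm_rpow (by simpa using hp0) (by simp)
    rwa [ENNReal.toReal_ofReal hp0.le] at this
  have hmem : MemLp (fun x => ‖θ₀ x‖ ^ (p / 2)) 2 (volume : Measure Plane) := by
    rw [memLp_two_iff_integrable_sq]
    · refine hint.congr (Filter.Eventually.of_forall fun x => ?_)
      dsimp only
      rw [← Real.rpow_mul_natCast (norm_nonneg _)]
      congr 1; push_cast; ring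
    · exact ((Lp.aestronglyMeasurable θ₀).norm.aemeasurable.pow_const _).aestronglyMeasurable
  have hnorm : ‖hmem.toLp _‖ = √(∫ x, ‖θ₀ x‖ ^ p) := by
    rw [eq_comm, Real.sqrt_eq_iff_mul_self_eq hN (norm_nonneg _)]
    rw [← real_inner_self_eq_norm_mul_norm, L2.inner_def]
    apply integral_congr_ae
    filter_upwards [hmem.coeFn_toLp] with x hx
    rw [hx]
    simp only [RCLike.inner_apply, conj_trivial]
    rw [← Real.rpow_add_of_nonneg (norm_nonneg _) (by linarith) (by linarith)]
    congr 1; ring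
  -- A substitute for Hausdorff–Young: values above the height l are paired with the sup bound of
  -- the test function, values below l with its L² bound.
  have hpt : ∀ r : ℝ, 0 ≤ r → r ≤ l ^ (1 - p) * r ^ p + l ^ (1 - p / 2) * r ^ (p / 2) := by
    intro r hr
    rcases eq_or_lt_of_le hr with h0 | h0
    · rw [← h0]; positivity
    rcases le_total r l with h1 | h1
    · have : r ≤ l ^ (1 - p / 2) * r ^ (p / 2) := by
        calc r = r ^ (1 - p / 2) * r ^ (p / 2) := by rw [← Real.rpow_add h0]; simp
          _ ≤ _ := by gcongr; linarith
      have : 0 ≤ l ^ (1 - p) * r ^ p := by positivity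
      linarith
    · have : r ≤ l ^ (1 - p) * r ^ p := by
        calc r = r ^ (1 - p) * r ^ p := by rw [← Real.rpow_add h0]; simp
          _ ≤ _ := by
            gcongr ?_ * _
            exact Real.rpow_le_rpow_of_nonpos hl h1 (by linarith)
      have : 0 ≤ l ^ (1 - p / 2) * r ^ (p / 2) := by positivity
      linarith
  refine norm_le_of_forall_schwartz (by positivity) fun ψ => ?_
  rw [← pairing_test]
  set φ : 𝓢(Plane, ℂ) := 𝓕⁻ (schwartzMul η ψ) with hφ
  set N := ‖ψ.toLp 2 (volume : Measure Plane)‖ with hN'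
  have hsup : ∀ x, ‖φ x‖ ≤ v * N := fun x =>
    (norm_fourierInv_le _ x).trans ((integral_norm_schwartzMul_le η ψ).trans
      (by gcongr; exact hη.mass))
  have hL2 : ‖φ.toLp 2 (volume : Measure Plane)‖ ≤ N := by
    rw [hφ, ← SchwartzMap.toLp_fourierInv_eq, ← Lp.norm_fourier_eq,
      FourierTransform.fourier_fourierInv_eq]
    apply Lp.norm_le_norm_of_ae_le
    filter_upwards [(schwartzMul η ψ).coeFn_toLp 2 volume, ψ.coeFn_toLp 2 volume] with ξ h1 h2
    rw [h1, h2, schwartzMul_apply, norm_mul, Complex.norm_real, Real.norm_of_nonneg (hη.nonneg ξ)]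
    exact mul_le_of_le_one_left (norm_nonneg _) (hη.le_one ξ)
  have j1 : Integrable (fun x => (v * N) * l ^ (1 - p) * ‖θ₀ x‖ ^ p) := hint.const_mul _
  have j2 : Integrable (fun x => l ^ (1 - p / 2) * (‖‖θ₀ x‖ ^ (p / 2)‖ * ‖φ x‖)) :=
    (integrable_norm_mul_norm hmem (φ.memLp 2)).const_mul _
  unfold pairing
  calc _ ≤ ∫ x, ((v * N) * l ^ (1 - p) * ‖θ₀ x‖ ^ p +
        l ^ (1 - p / 2) * (‖‖θ₀ x‖ ^ (p / 2)‖ * ‖φ x‖)) := by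
        refine norm_integral_le_of_norm_le (j1.add j2) ?_
        filter_upwards [ContinuousLinearMap.coeFn_compLp Complex.ofRealCLM θ₀,
          φ.coeFn_toLp 2 volume] with x h1 h2
        unfold toComplex
        rw [h1, h2, norm_mul, Real.norm_of_nonneg (by positivity : 0 ≤ ‖θ₀ x‖ ^ (p / 2))]
        simp only [Complex.ofRealCLM_apply, Complex.norm_real]
        calc ‖θ₀ x‖ * ‖φ x‖ ≤ (l ^ (1 - p) * ‖θ₀ x‖ ^ p +
              l ^ (1 - p / 2) * ‖θ₀ x‖ ^ (p / 2)) * ‖φ x‖ := by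
              gcongr; exact hpt _ (norm_nonneg _)
          _ = l ^ (1 - p) * ‖θ₀ x‖ ^ p * ‖φ x‖ + l ^ (1 - p / 2) * (‖θ₀ x‖ ^ (p / 2) * ‖φ x‖) := by
              ring
          _ ≤ l ^ (1 - p) * ‖θ₀ x‖ ^ p * (v * N) +
              l ^ (1 - p / 2) * (‖θ₀ x‖ ^ (p / 2) * ‖φ x‖) := by
              gcongr; exact hsup x
          _ = _ := by ring
    _ ≤ (v * N) * l ^ (1 - p) * (∫ x, ‖θ₀ x‖ ^ p) +
        l ^ (1 - p / 2) * (√(∫ x, ‖θ₀ x‖ ^ p) * N) := by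
        rw [integral_add j1 j2, integral_const_mul, integral_const_mul]
        gcongr
        rw [← hnorm]
        exact (integral_norm_mul_norm_le hmem (φ.memLp 2)).trans (by gcongr; exact hL2)
    _ = _ := by ring

/-- The dissipation controls the high frequencies. -/
theorem IsLowPass.le_dissipation (hη : IsLowPass m g b v η) (hg : 0 ≤ g) (f : L2R) :
    ENNReal.ofReal (g * (‖f‖ ^ 2 - lowNorm η f ^ 2)) ≤ dissipation m f := by
  set F : L2C := 𝓕 (toComplex f) with hF
  have hF2 : Integrable (fun ξ => ‖F ξ‖ ^ 2) := (Lp.memLp F).integrable_norm_pow two_ne_zero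
  have hc2 : Integrable (fun ξ => ‖cutoff η F ξ‖ ^ 2) :=
    (Lp.memLp (cutoff η F)).integrable_norm_pow two_ne_zero
  have hsq : ∀ G : L2C, ‖G‖ ^ 2 = ∫ ξ, ‖G ξ‖ ^ 2 := by
    intro G
    have h1 : inner ℂ G G = ((‖G‖ ^ 2 : ℝ) : ℂ) := by
      rw [inner_self_eq_norm_sq_to_K]; simp
    rw [L2.inner_def] at h1
    have h2 : ∫ ξ, inner ℂ (G ξ) (G ξ) = ((∫ ξ, ‖G ξ‖ ^ 2 : ℝ) : ℂ) := by
      rw [← integral_complex_ofReal]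
      congr 1; ext ξ
      rw [inner_self_eq_norm_sq_to_K]; simp
    rw [h2] at h1
    exact_mod_cast h1.symm
  have e : g * (‖f‖ ^ 2 - lowNorm η f ^ 2) = ∫ ξ, g * (‖F ξ‖ ^ 2 - ‖cutoff η F ξ‖ ^ 2) := by
    rw [integral_const_mul, integral_sub hF2 hc2, ← hsq, ← hsq, hF, Lp.norm_fourier_eq,
      norm_toComplex]
    rfl
  have hae : ∀ᵐ ξ, g * (‖F ξ‖ ^ 2 - ‖cutoff η F ξ‖ ^ 2) = g * (1 - η ξ ^ 2) * ‖F ξ‖ ^ 2 := by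
    filter_upwards [coeFn_cutoff η F] with ξ hξ
    rw [hξ, norm_mul, Complex.norm_real, mul_pow, Real.norm_eq_abs, sq_abs]
    ring
  have hi : Integrable (fun ξ => g * (‖F ξ‖ ^ 2 - ‖cutoff η F ξ‖ ^ 2)) := (hF2.sub hc2).const_mul g
  rw [e, ofReal_integral_eq_lintegral_ofReal hi]
  · unfold dissipation
    apply lintegral_mono_ae
    filter_upwards [hae] with ξ hξ
    rw [hξ, ← ofReal_norm, ← ENNReal.ofReal_pow (norm_nonneg _), ← ENNReal.ofReal_mul']
    · apply ENNReal.ofReal_le_ofReal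
      gcongr
      exact hη.high ξ
    · positivity
  · filter_upwards [hae] with ξ hξ
    rw [hξ]
    have h1 : η ξ ^ 2 ≤ 1 := pow_le_one₀ (hη.nonneg ξ) (hη.le_one ξ)
    have : 0 ≤ 1 - η ξ ^ 2 := by linarith
    simp only [Pi.zero_apply]
    positivity

end WeakSolution

/-! ### The two symbols and the anisotropic cutoff -/

/-- The symbol `m` is comparable with `|2πξ₀|^(2α) + |2πξ₁|^(2β)`. -/
structure IsAnisotropic (α β : ℝ) (m : Plane → ℝ) : Prop where
  measurable : Measurable m
  le_zero : ∀ ξ, |2 * Real.pi * ξ 0| ^ (2 * α) ≤ m ξ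
  le_one : ∀ ξ, |2 * Real.pi * ξ 1| ^ (2 * β) ≤ m ξ
  le : ∀ g > 0, ∀ ξ, |2 * Real.pi * ξ 0| ≤ 2 * g ^ (1 / (2 * α)) →
    |2 * Real.pi * ξ 1| ≤ 2 * g ^ (1 / (2 * β)) → m ξ ≤ 8 * g

/-- As α ≤ 1 and c ≥ 1, c^(2α) ≤ c². The constant 8 in `IsAnisotropic` is 4 + 4 (c = 2 in each
variable) or 8 (c = √8 for the full norm). -/
theorem two_mul_rpow_le {α g x c : ℝ} (hα : 0 < α) (hα1 : α ≤ 1) (hg : 0 < g) (hx : 0 ≤ x)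
    (hc : 1 ≤ c) (h : x ≤ c * g ^ (1 / (2 * α))) : x ^ (2 * α) ≤ c ^ 2 * g := by
  calc x ^ (2 * α) ≤ (c * g ^ (1 / (2 * α))) ^ (2 * α) := by gcongr
    _ = c ^ (2 * α) * g := by
        rw [Real.mul_rpow (by positivity) (by positivity), ← Real.rpow_mul hg.le,
          one_div_mul_cancel (by positivity), Real.rpow_one]
    _ ≤ c ^ (2 : ℝ) * g := by
        gcongr
        linarith
    _ = _ := by norm_num

theorem norm_sq_eq (ξ : Plane) : ‖ξ‖ ^ 2 = |ξ 0| ^ 2 + |ξ 1| ^ 2 := by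
  rw [EuclideanSpace.norm_sq_eq, Fin.sum_univ_two]; simp

theorem isAnisotropic_anisotropicSymbol {α β : ℝ} (hα : 0 < α) (hα1 : α ≤ 1) (hβ : 0 < β)
    (hβ1 : β ≤ 1) : IsAnisotropic α β (anisotropicSymbol α β) where
  measurable := by
    unfold anisotropicSymbol
    fun_prop
  le_zero ξ := le_add_of_nonneg_right (by positivity)
  le_one ξ := le_add_of_nonneg_left (by positivity)
  le g hg ξ h0 h1 := by
    have e0 := two_mul_rpow_le hα hα1 hg (abs_nonneg _) one_le_two h0
    have e1 := two_mul_rpow_le hβ hβ1 hg (abs_nonneg _) one_le_two h1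
    unfold anisotropicSymbol
    linarith

theorem isAnisotropic_isotropicSymbol {α : ℝ} (hα : 0 < α) (hα1 : α ≤ 1) :
    IsAnisotropic α α (isotropicSymbol α) := by
  have hle : ∀ (ξ : Plane) (j : Fin 2), |2 * Real.pi * ξ j| ≤ 2 * Real.pi * ‖ξ‖ := by
    intro ξ j
    rw [abs_mul, abs_of_pos Real.two_pi_pos]
    gcongr
    simpa using PiLp.norm_apply_le ξ j
  refine ⟨?_, fun ξ => ?_, fun ξ => ?_, fun g hg ξ h0 h1 => ?_⟩
  · unfold isotropicSymbol
    fun_prop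
  · unfold isotropicSymbol
    gcongr
    exact hle ξ 0
  · unfold isotropicSymbol
    gcongr
    exact hle ξ 1
  · have e : 2 * Real.pi * ‖ξ‖ ≤ √8 * g ^ (1 / (2 * α)) := by
      apply le_of_sq_le_sq _ (by positivity)
      rw [mul_pow, norm_sq_eq, mul_pow √8, Real.sq_sqrt (by norm_num)]
      rw [abs_mul, abs_of_pos Real.two_pi_pos] at h0 h1
      have := pow_le_pow_left₀ (by positivity) h0 2
      have := pow_le_pow_left₀ (by positivity) h1 2
      nlinarith
    have := two_mul_rpow_le hα hα1 hg (by positivity) (Real.one_le_sqrt.2 (by norm_num)) e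
    rwa [Real.sq_sqrt (by norm_num)] at this

theorem volume_box (a : Fin 2 → ℝ) :
    (volume : Measure Plane) {ξ | ∀ j, |ξ j| ≤ a j} =
      ENNReal.ofReal (2 * a 0) * ENNReal.ofReal (2 * a 1) := by
  have e : {ξ : Plane | ∀ j, |ξ j| ≤ a j} = WithLp.ofLp ⁻¹' Icc (fun j => - a j) a := by
    ext ξ
    simp only [abs_le, forall_and, mem_ofPred_eq, mem_preimage, mem_Icc, Pi.le_def]
  rw [e, (PiLp.volume_preserving_ofLp (Fin 2)).measure_preimage
    measurableSet_Icc.nullMeasurableSet, Real.volume_Icc_pi, Fin.prod_univ_two]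
  congr 2 <;> ring

theorem norm_toLp_le_of_support_box (η : 𝓢(Plane, ℝ)) (a : Fin 2 → ℝ) (ha : ∀ j, 0 ≤ a j)
    (h1 : ∀ ξ, |η ξ| ≤ 1) (hs : ∀ ξ, η ξ ≠ 0 → ∀ j, |ξ j| ≤ a j) :
    ‖η.toLp 2 (volume : Measure Plane)‖ ≤ √((2 * a 0) * (2 * a 1)) := by
  have hvol : (2 * a 0) * (2 * a 1) = (volume : Measure Plane).real {ξ | ∀ j, |ξ j| ≤ a j} := by
    rw [Measure.real, volume_box, ENNReal.toReal_mul, ENNReal.toReal_ofReal (by linarith [ha 0]),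
      ENNReal.toReal_ofReal (by linarith [ha 1])]
  rw [SchwartzMap.norm_toLp' two_ne_zero ENNReal.ofNat_ne_top, hvol, Real.sqrt_eq_rpow]
  have hmeas : MeasurableSet {ξ : Plane | ∀ j, |ξ j| ≤ a j} := by
    rw [ofPred_forall]
    exact MeasurableSet.iInter fun j => measurableSet_le (by fun_prop) (by fun_prop)
  have hfin : volume {ξ : Plane | ∀ j, |ξ j| ≤ a j} ≠ ⊤ := by
    rw [volume_box]; finiteness
  simp only [ENNReal.toReal_ofNat, one_div]
  gcongr
  rw [← integral_indicator_one hmeas]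
  refine integral_mono_of_nonneg (Filter.Eventually.of_forall fun ξ => by positivity)
    ((integrable_indicator_iff hmeas).2 (integrableOn_const hfin))
    (Filter.Eventually.of_forall fun ξ => ?_)
  dsimp only
  by_cases h0 : η ξ = 0
  · rw [h0]
    simp only [norm_zero]
    rw [Real.zero_rpow two_ne_zero]
    exact indicator_nonneg (fun _ _ => zero_le_one) _
  · rw [indicator_of_mem (show ξ ∈ {ξ : Plane | ∀ j, |ξ j| ≤ a j} from hs ξ h0)]
    exact Real.rpow_le_one (norm_nonneg _) (h1 ξ) (by norm_num)

/-- The cutoff is a product of one-dimensional bumps in 2πξ₀/A and 2πξ₁/B. Its support lies in the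
box |ξ₀| ≤ A/π, |ξ₁| ≤ B/π, of measure at most AB. -/
theorem exists_isLowPass {α β : ℝ} {m : Plane → ℝ} (hα : 0 < α) (hβ : 0 < β)
    (hm : IsAnisotropic α β m) {g : ℝ} (hg : 0 < g) :
    ∃ η, IsLowPass m g (g ^ (1 / (2 * α)) + g ^ (1 / (2 * β)))
      √(g ^ (1 / (2 * α) + 1 / (2 * β))) η := by
  set A := g ^ (1 / (2 * α)) with hA
  set B := g ^ (1 / (2 * β)) with hB
  have hA0 : 0 < A := by positivity
  have hB0 : 0 < B := by positivity
  have hπ := Real.pi_gt_three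
  let χ : ContDiffBump (0 : ℝ) := ⟨1, 2, one_pos, one_lt_two⟩
  have hχ1 : ∀ x : ℝ, |x| ≤ 1 → χ x = 1 := fun x hx =>
    χ.one_of_mem_closedBall (by simpa [χ] using hx)
  have hχ0 : ∀ x : ℝ, χ x ≠ 0 → |x| ≤ 2 := by
    intro x hx
    by_contra! h
    exact hx (χ.zero_of_le_dist (by simpa [χ] using h.le))
  let f : Plane → ℝ := fun ξ => χ (2 * Real.pi * ξ 0 / A) * χ (2 * Real.pi * ξ 1 / B)
  have hsupp : ∀ ξ, f ξ ≠ 0 → |2 * Real.pi * ξ 0| ≤ 2 * A ∧ |2 * Real.pi * ξ 1| ≤ 2 * B := by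
    intro ξ hξ
    have h0 := hχ0 _ (left_ne_zero_of_mul hξ)
    have h1 := hχ0 _ (right_ne_zero_of_mul hξ)
    rw [abs_div, abs_of_pos hA0, div_le_iff₀ hA0] at h0
    rw [abs_div, abs_of_pos hB0, div_le_iff₀ hB0] at h1
    exact ⟨h0, h1⟩
  set a : Fin 2 → ℝ := ![A / Real.pi, B / Real.pi] with ha
  have ha0 : ∀ j, 0 ≤ a j := by
    intro j
    fin_cases j <;> simp [ha] <;> positivity
  have hbox : ∀ ξ, f ξ ≠ 0 → ∀ j, |ξ j| ≤ a j := by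
    intro ξ hξ j
    obtain ⟨h0, h1⟩ := hsupp ξ hξ
    rw [abs_mul, abs_of_pos Real.two_pi_pos] at h0 h1
    fin_cases j
    · simp only [ha, Fin.zero_eta, Matrix.cons_val_zero]
      rw [le_div_iff₀ Real.pi_pos]; linarith
    · simp only [ha, Fin.mk_one, Matrix.cons_val_one, Matrix.cons_val_fin_one]
      rw [le_div_iff₀ Real.pi_pos]; linarith
  have hcomp : HasCompactSupport f := by
    refine HasCompactSupport.intro (isCompact_closedBall (0 : Plane) (a 0 + a 1)) fun ξ hξ => ?_
    by_contra h
    apply hξ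
    have h0 := hbox ξ h 0
    have h1 := hbox ξ h 1
    rw [mem_closedBall_zero_iff]
    apply le_of_sq_le_sq _ (add_nonneg (ha0 0) (ha0 1))
    rw [norm_sq_eq]
    nlinarith [abs_nonneg (ξ 0), abs_nonneg (ξ 1), ha0 0, ha0 1]
  have hsmooth : ContDiff ℝ ((⊤ : ℕ∞) : WithTop ℕ∞) f := by
    apply ContDiff.mul
    · exact χ.contDiff.comp (by fun_prop)
    · exact χ.contDiff.comp (by fun_prop)
  refine ⟨hcomp.toSchwartzMap hsmooth, ?_, ?_, ?_, ?_, ?_, ?_⟩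
  · exact fun ξ => mul_nonneg χ.nonneg χ.nonneg
  · exact fun ξ => mul_le_one₀ χ.le_one χ.nonneg χ.le_one
  · intro ξ
    change g * (1 - f ξ ^ 2) ≤ m ξ
    have hm0 : 0 ≤ m ξ := le_trans (by positivity) (hm.le_zero ξ)
    by_cases h : |2 * Real.pi * ξ 0| ≤ A ∧ |2 * Real.pi * ξ 1| ≤ B
    · have h0 : f ξ = 1 := by
        simp only [f]
        rw [hχ1, hχ1, one_mul]
        · rw [abs_div, abs_of_pos hB0, div_le_one hB0]; exact h.2
        · rw [abs_div, abs_of_pos hA0, div_le_one hA0]; exact h.1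
      rw [h0]; simpa using hm0
    -- Outside the inner box one of the two one-dimensional symbols is already at least g.
    · have hgm : g ≤ m ξ := by
        by_cases h0 : |2 * Real.pi * ξ 0| ≤ A
        · have h1 : B ≤ |2 * Real.pi * ξ 1| := by
            by_contra! h2; exact h ⟨h0, h2.le⟩
          refine le_trans ?_ (hm.le_one ξ)
          calc g = B ^ (2 * β) := by
                rw [hB, ← Real.rpow_mul hg.le, one_div_mul_cancel (by positivity), Real.rpow_one]
            _ ≤ _ := by gcongr
        · refine le_trans ?_ (hm.le_zero ξ)
          calc g = A ^ (2 * α) := by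
                rw [hA, ← Real.rpow_mul hg.le, one_div_mul_cancel (by positivity), Real.rpow_one]
            _ ≤ _ := by push Not at h0; gcongr
      nlinarith [sq_nonneg (f ξ)]
  · intro ξ hξ
    obtain ⟨h0, h1⟩ := hsupp ξ hξ
    exact hm.le g hg ξ h0 h1
  · intro ξ j hξ
    refine (hbox ξ hξ j).trans ?_
    have e0 : A / Real.pi ≤ A := div_le_self hA0.le (by linarith)
    have e1 : B / Real.pi ≤ B := div_le_self hB0.le (by linarith)
    fin_cases j
    · simp only [ha, Fin.zero_eta, Matrix.cons_val_zero]; linarith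
    · simp only [ha, Fin.mk_one, Matrix.cons_val_one, Matrix.cons_val_fin_one]; linarith
  · refine (norm_toLp_le_of_support_box _ a ha0 ?_ hbox).trans ?_
    · intro ξ
      change |f ξ| ≤ 1
      rw [abs_of_nonneg (mul_nonneg χ.nonneg χ.nonneg)]
      exact mul_le_one₀ χ.le_one χ.nonneg χ.le_one
    · apply Real.sqrt_le_sqrt
      rw [Real.rpow_add hg, ← hA, ← hB]
      simp only [ha, Matrix.cons_val_zero, Matrix.cons_val_one, Matrix.cons_val_fin_one]
      have e0 : 2 * (A / Real.pi) ≤ A := by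
        rw [← mul_div_assoc, div_le_iff₀ Real.pi_pos]; nlinarith
      have e1 : 2 * (B / Real.pi) ≤ B := by
        rw [← mul_div_assoc, div_le_iff₀ Real.pi_pos]; nlinarith
      gcongr

/-! ### Assembly -/

theorem ofReal_integral_le_lintegral {X : Type*} [MeasurableSpace X] {μ : Measure X} {f : X → ℝ}
    (hf : Integrable f μ) : ENNReal.ofReal (∫ x, f x ∂μ) ≤ ∫⁻ x, ENNReal.ofReal (f x) ∂μ := by
  rw [integral_eq_lintegral_pos_part_sub_lintegral_neg_part hf]
  exact (ENNReal.ofReal_le_ofReal (sub_le_self _ ENNReal.toReal_nonneg)).trans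
    ENNReal.ofReal_toReal_le

/-- Used with f = g(y - F), which may be negative; `ENNReal.ofReal` then truncates it, and the
inequality survives. -/
theorem norm_sq_add_integral_le {V : Type*} [NormedAddCommGroup V] {f : ℝ → ℝ} {D : ℝ → ℝ≥0∞}
    {s t : ℝ} {u w : V} (hst : s ≤ t) (hf : IntervalIntegrable f volume s t)
    (hD : ∀ τ ∈ Icc s t, ENNReal.ofReal (f τ) ≤ D τ)
    (h : ‖u‖ₑ ^ 2 + 2 * ∫⁻ τ in Icc s t, D τ ≤ ‖w‖ₑ ^ 2) :
    ‖u‖ ^ 2 + ∫ τ in s..t, 2 * f τ ≤ ‖w‖ ^ 2 := by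
  rw [intervalIntegrable_iff_integrableOn_Icc_of_le hst] at hf
  have h1 : ENNReal.ofReal (∫ τ in s..t, 2 * f τ) ≤ 2 * ∫⁻ τ in Icc s t, D τ := by
    rw [intervalIntegral.integral_const_mul, ENNReal.ofReal_mul zero_le_two,
      intervalIntegral.integral_of_le hst, ← integral_Icc_eq_integral_Ioc]
    simp only [ENNReal.ofReal_ofNat]
    gcongr
    exact (ofReal_integral_le_lintegral hf).trans (setLIntegral_mono' measurableSet_Icc hD)
  rw [← ENNReal.ofReal_le_ofReal_iff (by positivity)]
  refine ENNReal.ofReal_add_le.trans ?_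
  rw [ENNReal.ofReal_pow (norm_nonneg _), ENNReal.ofReal_pow (norm_nonneg _), ofReal_norm,
    ofReal_norm]
  exact (add_le_add_right h1 _).trans h

theorem add_sq_mul_bound {a₀ x q C L Y : ℝ} (hC : a₀ ^ 2 ≤ C) (hx : x ^ 2 ≤ L * q) :
    (a₀ + 4 * Real.pi * x * Y) ^ 2 ≤ 2 * (C + 16 * Real.pi ^ 2 * (L * q) * Y ^ 2) := by
  have h1 : (a₀ + 4 * Real.pi * x * Y) ^ 2 ≤
      2 * (a₀ ^ 2 + 16 * Real.pi ^ 2 * x ^ 2 * Y ^ 2) := by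
    nlinarith [sq_nonneg (a₀ - 4 * Real.pi * x * Y)]
  refine h1.trans ?_
  gcongr

section Assembly

variable {α β p : ℝ} {m : Plane → ℝ} {θ₀ : L2R}

/-- The constant in the bound of the low frequencies below `κ / (1 + t)`. -/
noncomputable def splitConst (α β N κ : ℝ) : ℝ :=
  8 * Real.exp (32 * κ) * (N ^ 2 + 1 +
    16 * Real.pi ^ 2 * (2 * (κ ^ (1 / α - 1) + κ ^ (1 / β - 1))))

theorem IsWeakSolution.lowNorm_sq_le (hα : 0 < α) (hα1 : α ≤ 1) (hβ : 0 < β) (hβ1 : β ≤ 1)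
    (hp : 1 ≤ p) (hp2 : p < 2) (hm : IsAnisotropic α β m)
    (hθ₀ : MemLp θ₀ (ENNReal.ofReal p) (volume : Measure Plane)) {θ : ℝ → L2R}
    (h : IsWeakSolution m θ₀ θ) {κ : ℝ} (hκ : 0 < κ) {t : ℝ} (ht : 0 ≤ t) {η : 𝓢(Plane, ℝ)}
    (hη : IsLowPass m (κ / (1 + t))
      ((κ / (1 + t)) ^ (1 / (2 * α)) + (κ / (1 + t)) ^ (1 / (2 * β)))
      √((κ / (1 + t)) ^ (1 / (2 * α) + 1 / (2 * β))) η) :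
    lowNorm η (θ t) ^ 2 ≤
      splitError (splitConst α β ((∫ x, ‖θ₀ x‖ ^ p) + √(∫ x, ‖θ₀ x‖ ^ p)) κ) κ
        ((1 / (2 * α) + 1 / (2 * β)) * ((2 - p) / p)) (1 / (2 * α) + 1 / (2 * β))
        (fun s => ‖θ s‖ ^ 2) t := by
  set σ := 1 / (2 * α) + 1 / (2 * β) with hσ
  set I := ∫ x, ‖θ₀ x‖ ^ p with hI
  have hI0 : 0 ≤ I := integral_nonneg fun x => by positivity
  set g := κ / (1 + t) with hg'
  have hg : 0 < g := by positivity
  have hgκ : g ≤ κ := div_le_self hκ.le (by linarith)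
  have hgt : g * t ≤ κ := by
    rw [hg', div_mul_eq_mul_div, div_le_iff₀ (by positivity)]; nlinarith
  have hm0 : ∀ ξ, 0 ≤ m ξ := fun ξ => le_trans (by positivity) (hm.le_zero ξ)
  have hp0 : 0 < p := by linarith
  set N := I + √I with hN
  set Y := ∫ s in (0 : ℝ)..t, ‖θ s‖ ^ 2 with hY
  have hY0 : 0 ≤ Y := intervalIntegral.integral_nonneg ht fun _ _ => by positivity
  set q := g ^ σ with hq
  have hq0 : 0 < q := by positivity
  have ha : lowNorm η θ₀ ≤ N * q ^ (1 / p - 1 / 2) := by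
    -- The height l = q^(1/p) makes both terms equal to multiples of q^(1/p - 1/2).
    have h1 := hη.lowNorm_le_of_memLp hp hp2 (l := q ^ (1 / p)) (by positivity) hθ₀
    have e1 : √q * (q ^ (1 / p)) ^ (1 - p) = q ^ (1 / p - 1 / 2) := by
      rw [Real.sqrt_eq_rpow, ← Real.rpow_mul hq0.le, ← Real.rpow_add hq0]
      congr 1; field_simp; ring
    have e2 : (q ^ (1 / p)) ^ (1 - p / 2) = q ^ (1 / p - 1 / 2) := by
      rw [← Real.rpow_mul hq0.le]
      congr 1; field_simp
    rw [e1, e2] at h1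
    refine h1.trans (le_of_eq ?_)
    rw [hN]; ring
  have ha2 : lowNorm η θ₀ ^ 2 ≤ N ^ 2 * g ^ (σ * ((2 - p) / p)) := by
    refine (pow_le_pow_left₀ (norm_nonneg _) ha 2).trans (le_of_eq ?_)
    rw [mul_pow, hq, ← Real.rpow_mul hg.le, ← Real.rpow_mul_natCast hg.le]
    congr 2; push_cast; field_simp
  set L := 2 * (κ ^ (1 / α - 1) + κ ^ (1 / β - 1)) with hL
  set b := g ^ (1 / (2 * α)) + g ^ (1 / (2 * β)) with hb
  -- Each g^(1/a) is split as g · g^(1/a - 1), and the second factor is bounded by its value at κ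
  -- because 1/a ≥ 1 and g ≤ κ.
  have hbv : (b * √q) ^ 2 ≤ L * g ^ (1 + σ) := by
    have hα' : 0 ≤ 1 / α - 1 := by rw [sub_nonneg, le_div_iff₀ hα]; linarith
    have hβ' : 0 ≤ 1 / β - 1 := by rw [sub_nonneg, le_div_iff₀ hβ]; linarith
    have e : ∀ a : ℝ, 0 < a → (g ^ (1 / (2 * a))) ^ 2 = g * g ^ (1 / a - 1) := by
      intro a ha
      rw [← Real.rpow_mul_natCast hg.le]
      nth_rw 2 [← Real.rpow_one g]
      rw [← Real.rpow_add hg]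
      congr 1; push_cast; field_simp; ring
    rw [mul_pow, Real.sq_sqrt hq0.le, Real.rpow_add hg, Real.rpow_one, ← hq]
    have h1 : b ^ 2 ≤ 2 * ((g ^ (1 / (2 * α))) ^ 2 + (g ^ (1 / (2 * β))) ^ 2) := add_sq_le
    rw [e α hα, e β hβ] at h1
    have h2 : g ^ (1 / α - 1) ≤ κ ^ (1 / α - 1) := by gcongr
    have h3 : g ^ (1 / β - 1) ≤ κ ^ (1 / β - 1) := by gcongr
    calc b ^ 2 * q ≤ 2 * (g * κ ^ (1 / α - 1) + g * κ ^ (1 / β - 1)) * q := by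
          gcongr
          refine h1.trans ?_
          gcongr
      _ = _ := by rw [hL]; ring
  have hlow := h.lowNorm_le hη hm.measurable hm0 hg (by positivity) ht
  have hexp : Real.exp (2 * (8 * g) * t) ^ 2 ≤ Real.exp (32 * κ) := by
    rw [← Real.exp_nat_mul]
    apply Real.exp_le_exp.2
    push_cast
    linarith
  have hL0 : 0 < L := by positivity
  have hbd := add_sq_mul_bound (Y := Y) ha2 hbv
  calc lowNorm η (θ t) ^ 2
      ≤ (2 * (lowNorm η θ₀ + 4 * Real.pi * b * √q * Y) * Real.exp (2 * (8 * g) * t)) ^ 2 := by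
        gcongr
        exact norm_nonneg _
    _ = 4 * (lowNorm η θ₀ + 4 * Real.pi * (b * √q) * Y) ^ 2 * Real.exp (2 * (8 * g) * t) ^ 2 := by
        ring
    _ ≤ 4 * (2 * (N ^ 2 * g ^ (σ * ((2 - p) / p)) +
          16 * Real.pi ^ 2 * (L * g ^ (1 + σ)) * Y ^ 2)) * Real.exp (32 * κ) := by
        gcongr
    _ = 8 * Real.exp (32 * κ) * (N ^ 2 * g ^ (σ * ((2 - p) / p)) +
          16 * Real.pi ^ 2 * L * (g ^ (1 + σ) * Y ^ 2)) := by ring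
    _ ≤ 8 * Real.exp (32 * κ) * ((N ^ 2 + 1 + 16 * Real.pi ^ 2 * L) * g ^ (σ * ((2 - p) / p)) +
          (N ^ 2 + 1 + 16 * Real.pi ^ 2 * L) * (g ^ (1 + σ) * Y ^ 2)) := by
        have : 0 ≤ 16 * Real.pi ^ 2 * L := by positivity
        gcongr
        · linarith
        · nlinarith [sq_nonneg N]
    _ = _ := by
        unfold splitError splitConst
        ring

theorem IsWeakSolution.splitEnergy (hα : 0 < α) (hα1 : α ≤ 1) (hβ : 0 < β) (hβ1 : β ≤ 1)
    (hp : 1 ≤ p) (hp2 : p < 2) (hm : IsAnisotropic α β m)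
    (hθ₀ : MemLp θ₀ (ENNReal.ofReal p) (volume : Measure Plane)) {θ : ℝ → L2R}
    (h : IsWeakSolution m θ₀ θ) {κ : ℝ} (hκ : 0 < κ) :
    SplitEnergy (‖θ₀‖ ^ 2) κ
      (splitError (splitConst α β ((∫ x, ‖θ₀ x‖ ^ p) + √(∫ x, ‖θ₀ x‖ ^ p)) κ) κ
        ((1 / (2 * α) + 1 / (2 * β)) * ((2 - p) / p)) (1 / (2 * α) + 1 / (2 * β))
        (fun s => ‖θ s‖ ^ 2)) (fun s => ‖θ s‖ ^ 2) := by
  set F := splitError (splitConst α β ((∫ x, ‖θ₀ x‖ ^ p) + √(∫ x, ‖θ₀ x‖ ^ p)) κ) κ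
        ((1 / (2 * α) + 1 / (2 * β)) * ((2 - p) / p)) (1 / (2 * α) + 1 / (2 * β))
        (fun s => ‖θ s‖ ^ 2) with hF
  have hmeas : AEStronglyMeasurable (fun s => ‖θ s‖ ^ 2) (volume.restrict (Ici (0 : ℝ))) :=
    h.measurable.norm.pow 2
  have hbd : ∀ t, 0 ≤ t → 0 ≤ ‖θ t‖ ^ 2 ∧ ‖θ t‖ ^ 2 ≤ ‖θ₀‖ ^ 2 :=
    fun t ht => ⟨by positivity, by gcongr; exact h.norm_le ht⟩
  -- A new cutoff is chosen at every τ. The bound F no longer mentions it, so no regularity of the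
  -- choice in τ is needed.
  have hD : ∀ τ, 0 ≤ τ → ENNReal.ofReal (κ / (1 + τ) * (‖θ τ‖ ^ 2 - F τ)) ≤
      dissipation m (θ τ) := by
    intro τ hτ
    have hg : 0 < κ / (1 + τ) := by positivity
    obtain ⟨η, hη⟩ := exists_isLowPass hα hβ hm hg
    refine le_trans (ENNReal.ofReal_le_ofReal ?_) (hη.le_dissipation hg.le (θ τ))
    gcongr
    exact h.lowNorm_sq_le hα hα1 hβ hβ1 hp hp2 hm hθ₀ hκ hτ hη
  have hint : ∀ s t, 0 ≤ s → s ≤ t →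
      IntervalIntegrable (fun τ => κ / (1 + τ) * (‖θ τ‖ ^ 2 - F τ)) volume s t := by
    intro s t hs hst
    have hsub : uIcc s t ⊆ Icc 0 t := by rw [uIcc_of_le hst]; exact Icc_subset_Icc_left hs
    have hc := continuousOn_splitError (K := splitConst α β ((∫ x, ‖θ₀ x‖ ^ p) +
      √(∫ x, ‖θ₀ x‖ ^ p)) κ) (r := (1 / (2 * α) + 1 / (2 * β)) * ((2 - p) / p))
      (σ := 1 / (2 * α) + 1 / (2 * β)) hκ hmeas hbd (hs.trans hst)
    refine ((intervalIntegrable_of_bounded hmeas hbd hs hst).sub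
      (hc.mono hsub).intervalIntegrable).continuousOn_mul ?_
    apply ContinuousOn.div continuousOn_const (by fun_prop)
    intro x hx
    have := (hsub hx).1
    positivity
  constructor
  · intro t ht
    have := norm_sq_add_integral_le ht (hint 0 t le_rfl ht) (fun τ hτ => hD τ hτ.1)
      (h.energy_zero t ht)
    simpa only [mul_assoc] using this
  · filter_upwards [h.energy, ae_restrict_mem measurableSet_Ici] with s hs hs0 t hst
    have := norm_sq_add_integral_le hst (hint s t hs0 hst)
      (fun τ hτ => hD τ (le_trans hs0 hτ.1)) (hs t hst)
    simpa only [mul_assoc] using this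

theorem exists_norm_decay (hα : 0 < α) (hα1 : α ≤ 1) (hβ : 0 < β) (hβ1 : β ≤ 1)
    (hp : 1 ≤ p) (hp2 : p < 2) (hm : IsAnisotropic α β m)
    (hθ₀ : MemLp θ₀ (ENNReal.ofReal p) (volume : Measure Plane)) :
    ∃ C : ℝ, 0 < C ∧ ∀ θ : ℝ → L2R, IsWeakSolution m θ₀ θ → ∀ t : ℝ, 0 ≤ t →
      ‖θ t‖ ≤ C * (1 + t) ^ (-((α + β) * (2 - p) / (4 * α * β * p))) := by
  have hp0 : 0 < p := by linarith
  have hσ : 1 ≤ 1 / (2 * α) + 1 / (2 * β) := by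
    have h1 : 1 / 2 ≤ 1 / (2 * α) := by gcongr; linarith
    have h2 : 1 / 2 ≤ 1 / (2 * β) := by gcongr; linarith
    linarith
  set σ := 1 / (2 * α) + 1 / (2 * β) with hσ'
  have hr : 0 < σ * ((2 - p) / p) := by
    have : 0 < 2 - p := by linarith
    positivity
  have hrσ : σ * ((2 - p) / p) ≤ σ := by
    apply mul_le_of_le_one_right (by linarith)
    rw [div_le_one hp0]; linarith
  set N := (∫ x, ‖θ₀ x‖ ^ p) + √(∫ x, ‖θ₀ x‖ ^ p) with hN
  have hα' : 0 ≤ 1 / α - 1 := by rw [sub_nonneg, le_div_iff₀ hα]; linarith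
  have hβ' : 0 ≤ 1 / β - 1 := by rw [sub_nonneg, le_div_iff₀ hβ]; linarith
  -- The constant C₁ is `splitConst` with exp(32κ) replaced by exp(32) and both powers of κ by 1, as
  -- κ ≤ 1 permits.
  obtain ⟨C, hC, hdecay⟩ := exists_decay (E := ‖θ₀‖ ^ 2) (K := splitConst α β N)
    (C₁ := 8 * Real.exp (32 * 1) * (N ^ 2 + 1 + 16 * Real.pi ^ 2 * (2 * (1 + 1)))) hσ hr hrσ
    (by positivity) (fun κ hκ => by unfold splitConst; positivity) (fun κ hκ hκ1 => by
      unfold splitConst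
      gcongr
      · exact Real.rpow_le_one hκ.le hκ1 hα'
      · exact Real.rpow_le_one hκ.le hκ1 hβ')
  refine ⟨√C, Real.sqrt_pos.2 hC, fun θ h t ht => ?_⟩
  have key := hdecay (fun s => ‖θ s‖ ^ 2) (h.measurable.norm.pow 2)
    (fun t ht => ⟨by positivity, by gcongr; exact h.norm_le ht⟩)
    (fun κ hκ => h.splitEnergy hα hα1 hβ hβ1 hp hp2 hm hθ₀ hκ) t ht
  apply le_of_sq_le_sq _ (by positivity)
  rw [mul_pow, Real.sq_sqrt hC.le, ← Real.rpow_mul_natCast (by positivity)]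
  refine key.trans_eq ?_
  congr 2
  rw [hσ']
  push_cast
  field_simp
  ring

end Assembly

end AnisoSQG

theorem proposition3p2 (α β p : ℝ) (hα : 0 < α ∧ α ≤ 1) (hβ : 0 < β ∧ β ≤ 1)
    (hp : 1 ≤ p ∧ p < 2)
    (m : AnisoSQG.Plane → ℝ)
    (hm : m = AnisoSQG.anisotropicSymbol α β ∨ (α = β ∧ m = AnisoSQG.isotropicSymbol α))
    (θ₀ : AnisoSQG.L2R)
    (hθ₀ : MemLp θ₀ (ENNReal.ofReal p) (volume : Measure AnisoSQG.Plane)) :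
    ∃ C : ℝ, 0 < C ∧
      ∀ θ : ℝ → AnisoSQG.L2R, AnisoSQG.IsWeakSolution m θ₀ θ →
        ∀ t : ℝ, 0 ≤ t →
          ‖θ t‖ ≤ C * (1 + t) ^ (-((α + β) * (2 - p) / (4 * α * β * p))) := by
  rcases hm with rfl | ⟨rfl, rfl⟩
  · exact AnisoSQG.exists_norm_decay hα.1 hα.2 hβ.1 hβ.2 hp.1 hp.2
      (AnisoSQG.isAnisotropic_anisotropicSymbol hα.1 hα.2 hβ.1 hβ.2) hθ₀
  · exact AnisoSQG.exists_norm_decay hα.1 hα.2 hα.1 hα.2 hp.1 hp.2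
      (AnisoSQG.isAnisotropic_isotropicSymbol hα.1 hα.2) hθ₀
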